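/- Languages are sets of finite binary words. The levels of the boolean hierarchy over $\mathrm{NP}$ are $\mathrm{BH}_1=\mathrm{NP}$ and, for $k>1$, $\mathrm{BH}_k=\{A\setminus B : A\in\mathrm{NP},\ B\in\mathrm{BH}_{k-1}\}$. For classes of languages $\mathcal C_1,\mathcal C_2,\mathcal C_3$, let $\mathrm{P}^{\mathcal C_1[1]:\mathcal C_2[1],\mathcal C_3[1]}$ be the class of all languages accepted by a deterministic polynomial-time oracle machine that makes (at most) one query to a language $A\in\mathcal C_1$, followed, if the answer to this query is "no", by (at most) one query to a language $B\in\mathcal C_2$ and, if the answer is "yes", by (at most) one query to a language $C\in\mathcal C_3$. A language $L$ is $m$-truth-table reducible to a language $B$ if there is a polynomial-time computable function that maps each word $x$ to $m$ words $x_1,\dots,x_m$ and a predicate $\alpha$ of $m$ boolean variables such that $x\in L\iff\alpha(\chi_B(x_1),\dots,\chi_B(x_m))$, where $\chi_B$ is the characteristic function of $B$. Let $\mathrm{R}^p_{m\text{-tt}}(\mathrm{NP})$ be the class of all languages that are $m$-truth-table reducible to some language in $\mathrm{NP}$. **Theorem.** For all integers $j,k,l\ge 1$, $$\mathrm{P}^{\mathrm{BH}_j[1]:\mathrm{BH}_k[1],\mathrm{BH}_l[1]}=\begin{cases}\mathrm{R}^p_{(j+k+l-1)\text{-tt}}(\mathrm{NP})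 & \text{if } j \text{ is even and } l \text{ is odd},\\ \mathrm{R}^p_{(j+k+l)\text{-tt}}(\mathrm{NP}) & \text{otherwise.}\end{cases}$$ -/

import Mathlib

namespace QueryOrder

/-- Words over the binary alphabet. -/
abbrev Word : Type := List Bool

/-- A language is a set of binary words. -/
abbrev Lang : Type := Set Word

/-! ### Polynomial-time computable functions and the class NP -/

/-- `f` is computed by a deterministic multi-stack Turing machine in polynomial time; inputs and
outputs are written on the machine's stacks by means of `ea` and `eb`. -/
def PolyTime {α β αΓ βΓ : Type} (ea : α → List αΓ) (eb : β → List βΓ) (f : α → β) : Prop :=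
  Nonempty (Turing.TM2ComputableInPolyTime ea eb f)

/-- A pair of words, written down over two disjoint copies of the binary alphabet (so that the
border between the two components is visible). -/
def encodePair : Word × Word → List (Bool ⊕ Bool) :=
  (Computability.encodingProd (Computability.encodingList Bool)
    (Computability.encodingList Bool)).encode

/-- NP: the languages `{x | ∃ y, R x y}` where the relation `R` is decidable in polynomial time
and polynomially balanced (witnesses are polynomially short). -/
def NP : Set Lang :=
  {L | ∃ (R : Word × Word → Bool) (p : Polynomial ℕ),
    PolyTime encodePair Computability.encodeBool R ∧
    (∀ x y, R (x, y) = true → y.length ≤ p.eval x.length) ∧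
    ∀ x, x ∈ L ↔ ∃ y, R (x, y) = true}

/-! ### The boolean hierarchy -/

/-- `C₁ ⊖ C₂`: all differences of a language in `C₁` and a language in `C₂`. -/
def diffClass (C₁ C₂ : Set Lang) : Set Lang :=
  {L | ∃ A ∈ C₁, ∃ B ∈ C₂, L = A \ B}

/-- The levels of the boolean hierarchy: `BH 1 = NP` and `BH k = NP ⊖ BH (k - 1)` for `k > 1`.
(There is no level `0`; the value of `BH 0` is a placeholder.) -/
def BH : ℕ → Set Lang
  | 0 => ∅
  | 1 => NP
  | k + 2 => diffClass NP (BH (k + 1))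

/-! ### Truth-table reductions with `m` queries -/

/-- The truth table of a predicate of `m` boolean variables, as a list of `2 ^ m` bits. The `i`-th
bit is the value at the assignment given by the binary digits of `i`. -/
def truthTable {m : ℕ} (α : (Fin m → Bool) → Bool) : List Bool :=
  List.ofFn fun i : Fin (2 ^ m) => α fun t => (i : ℕ).testBit t

/-- How the output of a truth-table reduction is written down: the `m` query words, each followed
by the separator `none`, and then the truth table of the predicate. -/
def encodeTT {m : ℕ} (o : (Fin m → Word) × ((Fin m → Bool) → Bool)) : List (Option Bool) :=
  (List.ofFn fun i => (o.1 i).map some ++ [none]).flatten ++ (truthTable o.2).map some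

open Classical in
/-- The characteristic function of a language. -/
noncomputable def chi (B : Lang) (w : Word) : Bool := decide (w ∈ B)

/-- `A` is polynomial-time `m`-truth-table reducible to `B`. -/
def TTReducible (m : ℕ) (A B : Lang) : Prop :=
  ∃ f : Word → (Fin m → Word) × ((Fin m → Bool) → Bool),
    PolyTime id encodeTT f ∧
    ∀ x, x ∈ A ↔ (f x).2 (fun i => chi B ((f x).1 i)) = true

/-- The closure of the class `C` under polynomial-time `m`-truth-table reductions. -/
def RTT (m : ℕ) (C : Set Lang) : Set Lang := {L | ∃ B ∈ C, TTReducible m L B}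

/-! ### Adaptive oracle machines -/

/-- A deterministic oracle Turing machine: a multi-stack machine with a binary input stack `k₀`,
a binary query stack, query states, and an accept/reject verdict read off the internal state on
halting. If `ask l = some (n, y)` then the label `l` is a query state with "no"-successor `n` and
"yes"-successor `y`; if `ask l = none`, the ordinary statement `m l` is executed at `l`.
(The output stack `k₁` plays no special role.) -/
structure OracleTM extends Turing.FinTM2 where
  /-- The input alphabet is binary. -/
  inputAlphabet : Γ k₀ ≃ Bool
  /-- The stack on which queries are written. -/
  queryStack : K
  /-- The query alphabet is binary. -/
  queryAlphabet : Γ queryStack ≃ Bool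
  /-- The query states, with their successors after the answers "no" and "yes". -/
  ask : Λ → Option (Λ × Λ)
  /-- The verdict on halting. -/
  accept : σ → Bool

namespace OracleTM

variable (M : OracleTM)

/-- A configuration of an oracle machine: a configuration of the underlying machine, together with
the list of all oracle answers received so far, in the order in which they were received. -/
structure Cfg where
  /-- The configuration of the underlying machine. -/
  base : M.toFinTM2.Cfg
  /-- The answers received so far, first answer first. -/
  answers : List Bool

/-- The initial configuration on input `x`: the input is on the input stack (its first letter on
top), all other stacks are empty, and no query has been answered. -/
def init (x : Word) : M.Cfg where
  base :=
    { l := some M.main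
      var := M.initialState
      stk := Function.update (fun _ => []) M.k₀ (x.map M.inputAlphabet.symm) }
  answers := []

/-- The word on the query stack (its top symbol is the first letter). -/
def queryWord (c : M.Cfg) : Word := (c.base.stk M.queryStack).map M.queryAlphabet

/-- One step of an oracle machine. The oracle that answers a query may depend on the answers to the
earlier queries: after the answers `h`, the next query goes to the language `O h`. Each query
takes one step, in which the query stack is erased. -/
noncomputable def step (O : List Bool → Lang) (c : M.Cfg) : Option M.Cfg :=
  match c.base.l with
  | none => none
  | some l =>
    match M.ask l with
    | none => (M.toFinTM2.step c.base).map fun b => ⟨b, c.answers⟩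
    | some (n, y) =>
      some
        { base :=
            { l := some (if chi (O c.answers) (M.queryWord c) then y else n)
              var := c.base.var
              stk := Function.update c.base.stk M.queryStack [] }
          answers := c.answers ++ [chi (O c.answers) (M.queryWord c)] }

/-- With the oracles `O`, the machine halts on input `x` within `t` steps, in configuration `c`. -/
def HaltsIn (O : List Bool → Lang) (x : Word) (c : M.Cfg) (t : ℕ) : Prop :=
  Nonempty (StateTransition.EvalsToInTime (M.step O) (M.init x) (some c) t) ∧ c.base.l = none

/-- With the oracles `O`, the machine halts on input `x` with the verdict "accept". -/
def Accepts (O : List Bool → Lang) (x : Word) : Prop :=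
  ∃ (c : M.Cfg) (t : ℕ), M.HaltsIn O x c t ∧ M.accept c.base.var = true

/-- The machine is a polynomial-time machine making at most `q` queries (whatever the oracles). -/
def PolyTimeQueries (q : ℕ) : Prop :=
  ∃ p : Polynomial ℕ, ∀ (O : List Bool → Lang) (x : Word),
    ∃ c : M.Cfg, M.HaltsIn O x c (p.eval x.length) ∧ c.answers.length ≤ q

end OracleTM

/-- The first query goes to `A`; the second one goes to `B` if the first answer was "no", and to
`C` if it was "yes". (There are no further queries.) -/
def twoStage (A B C : Lang) : List Bool → Lang
  | [] => A
  | [false] => B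
  | [true] => C
  | _ => ∅

/-- `P^{C₁[1] : C₂[1], C₃[1]}`: the languages accepted by polynomial-time machines making one query
to an oracle from `C₁`, followed by one query to an oracle from `C₂` in case of a "no" answer, and
by one query to an oracle from `C₃` in case of a "yes" answer. -/
def queryClass (C₁ C₂ C₃ : Set Lang) : Set Lang :=
  {L | ∃ M : OracleTM, M.PolyTimeQueries 2 ∧
    ∃ A ∈ C₁, ∃ B ∈ C₂, ∃ C ∈ C₃, ∀ x, x ∈ L ↔ M.Accepts (twoStage A B C) x}

end QueryOrder

open Turing StateTransition

namespace QueryOrder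

/-! Both sides equal a class `MindChange m`: a polynomial-time guess `φ x`, corrected by the parity
of a number `N x ≤ m` whose thresholds `i < N x` are NP conditions.

Suppose that membership is a polynomial-time function `g` of the set `T` of those among finitely
many NP events that occur. A chain of sets inside `T` along which `g` changes `n` times is an NP
certificate, since it only asserts that events occur. Let `N x` be the largest such `n`. By
maximality `g T` is the value at the end of the chain, which is `g ∅` flipped `N x` times
(`mem_mindChange_of_events`). With `m` queries to NP there are `m` events, hence at most `m`
changes; conversely the `m` conditions `i < N x` can serve as queries. This gives
`mindChange_eq_RTT`.

A language in `BH n` is a nested difference of `n` NP events, so the tree of two queries depends on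
`j + k + l` events. One change is lost if `j` is even and `l` is odd: once all events occur, the
first answer is "no" again, and the outcome has the wrong parity for `j + k + l` changes
(`mem_mindChange_of_queries`). For the converse the count `N x` is cut into pieces: the first `k`
changes go to `B`, the next ones to `A`, the following `l` to `C`
(`exists_queries_of_mem_mindChange`).

The rest is machine work: NP and the polynomial-time functions have the needed closure properties,
the queries and the verdict of an oracle machine are polynomial-time functions of the input and the
earlier answers (`exists_two_queries`), and some oracle machine carries out the required two queries
(`exists_queryMachine`). -/

/-! ### Runs of transition systems with an exact number of steps -/

/-- `StepsTo f n a b`: the transition function `f` leads from `a` to `b` in exactly `n` steps. -/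
def StepsTo {C : Type} (f : C → Option C) : ℕ → C → C → Prop
  | 0, a, b => a = b
  | n + 1, a, b => ∃ c, f a = some c ∧ StepsTo f n c b

namespace StepsTo

variable {C : Type} {f : C → Option C}

theorem single {a b : C} (h : f a = some b) : StepsTo f 1 a b := ⟨b, h, rfl⟩

theorem trans {m n : ℕ} {a b c : C} (h₁ : StepsTo f m a b) (h₂ : StepsTo f n b c) :
    StepsTo f (m + n) a c := by
  induction m generalizing a with
  | zero => cases h₁; simpa using h₂
  | succ m ih =>
    obtain ⟨d, hd, h⟩ := h₁
    rw [Nat.add_right_comm]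
    exact ⟨d, hd, ih h⟩

theorem unique {m n : ℕ} {a b c : C} (h₁ : StepsTo f m a b) (h₂ : StepsTo f n a c)
    (hb : f b = none) (hc : f c = none) : b = c := by
  induction m generalizing a n with
  | zero =>
    cases h₁
    cases n with
    | zero => exact h₂
    | succ n => obtain ⟨d, hd, -⟩ := h₂; simp [hb] at hd
  | succ m ih =>
    obtain ⟨d, hd, h⟩ := h₁
    cases n with
    | zero => cases h₂; simp [hc] at hd
    | succ n =>
      obtain ⟨e, he, h'⟩ := h₂
      obtain rfl : d = e := by simpa [hd] using he
      exact ih h h'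

theorem iterate_none (n : ℕ) : (flip bind f)^[n] (none : Option C) = none := by
  induction n with
  | zero => rfl
  | succ n ih => rw [Function.iterate_succ_apply]; exact ih

theorem iff_iterate {n : ℕ} {a b : C} :
    StepsTo f n a b ↔ (flip bind f)^[n] (some a) = some b := by
  induction n generalizing a with
  | zero => simp [StepsTo]
  | succ n ih =>
    rw [Function.iterate_succ_apply]
    have : flip bind f (some a) = f a := rfl
    rw [this]
    cases h : f a with
    | none => rw [iterate_none]; simp [StepsTo, h]
    | some c => simp [StepsTo, h, ih]

end StepsTo

theorem evalsToInTime_iff {C : Type} {f : C → Option C} {a b : C} {t : ℕ} :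
    Nonempty (EvalsToInTime f a (some b) t) ↔ ∃ n ≤ t, StepsTo f n a b := by
  constructor
  · rintro ⟨⟨⟨n, h⟩, hn⟩⟩
    exact ⟨n, hn, StepsTo.iff_iterate.2 h⟩
  · rintro ⟨n, hn, h⟩
    exact ⟨⟨⟨n, StepsTo.iff_iterate.1 h⟩, hn⟩⟩

/-! ### Growth of the stacks -/

section Growth

variable {K : Type} [DecidableEq K] {Γ : K → Type} {Λ σ : Type}

/-- A statement has finitely many pushes and no loops. The constant turns time bounds into bounds on
the lengths of outputs and of stacks that have to be emptied. -/
theorem stepAux_growth (q : TM2.Stmt Γ Λ σ) :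
    ∃ c, ∀ v S k, ((TM2.stepAux q v S).stk k).length ≤ (S k).length + c := by
  induction q with
  | push k f q ih =>
    obtain ⟨c, hc⟩ := ih
    refine ⟨c + 1, fun v S k' => (hc _ _ _).trans ?_⟩
    by_cases h : k' = k
    · subst h; simp; omega
    · simp [h]
  | peek k f q ih => obtain ⟨c, hc⟩ := ih; exact ⟨c, fun v S k' => hc _ _ _⟩
  | pop k f q ih =>
    obtain ⟨c, hc⟩ := ih
    refine ⟨c, fun v S k' => (hc _ _ _).trans ?_⟩
    by_cases h : k' = k
    · subst h; simp
    · simp [h]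
  | load a q ih => obtain ⟨c, hc⟩ := ih; exact ⟨c, fun v S k' => hc _ _ _⟩
  | branch f q₁ q₂ ih₁ ih₂ =>
    obtain ⟨c₁, h₁⟩ := ih₁
    obtain ⟨c₂, h₂⟩ := ih₂
    refine ⟨c₁ + c₂, fun v S k => ?_⟩
    cases h : f v
    · simpa [h] using (h₂ v S k).trans (by omega)
    · simpa [h] using (h₁ v S k).trans (by omega)
  | goto f => exact ⟨0, fun v S k => by simp⟩
  | halt => exact ⟨0, fun v S k => by simp⟩

theorem program_growth [Finite Λ] (m : Λ → TM2.Stmt Γ Λ σ) :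
    ∃ c, ∀ l v S k, ((TM2.stepAux (m l) v S).stk k).length ≤ (S k).length + c := by
  choose c hc using fun l => stepAux_growth (m l)
  cases nonempty_fintype Λ
  exact ⟨∑ l, c l, fun l v S k => (hc l v S k).trans
    (Nat.add_le_add_left (Finset.single_le_sum (fun _ _ => Nat.zero_le _) (Finset.mem_univ l)) _)⟩

theorem StepsTo.growth {m : Λ → TM2.Stmt Γ Λ σ} {c : ℕ}
    (hc : ∀ l v S k, ((TM2.stepAux (m l) v S).stk k).length ≤ (S k).length + c) {n : ℕ}
    {a b : TM2.Cfg Γ Λ σ} (h : StepsTo (TM2.step m) n a b) (k : K) :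
    (b.stk k).length ≤ (a.stk k).length + c * n := by
  induction n generalizing a with
  | zero => cases h; simp
  | succ n ih =>
    obtain ⟨d, hd, h⟩ := h
    obtain ⟨_ | l, v, S⟩ := a
    · simp at hd
    · simp only [TM2.step, Option.some.injEq] at hd
      subst hd
      have h₁ := hc l v S k
      have h₂ := ih h
      simp only [Nat.mul_add, Nat.mul_one]
      omega

end Growth

/-! ### Embedding a machine into a larger one -/

section Lift

variable {K K' : Type} [DecidableEq K] [DecidableEq K'] {Γ' : K' → Type} {Λ Λ' σ σ' : Type}

/-- The statement `q` executed by a larger machine. The stacks are renamed by `ι`, the internal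
state of the small machine is a component of that of the larger one, the labels are renamed by `g`,
and halting is replaced by a jump to `e`. -/
def liftStmt (ι : K → K') (get : σ' → σ) (set : σ → σ' → σ') (g : Λ → Λ') (e : Option Λ') :
    TM2.Stmt (fun k => Γ' (ι k)) Λ σ → TM2.Stmt Γ' Λ' σ'
  | .push k f q => .push (ι k) (fun v => f (get v)) (liftStmt ι get set g e q)
  | .peek k f q => .peek (ι k) (fun v o => set (f (get v) o) v) (liftStmt ι get set g e q)
  | .pop k f q => .pop (ι k) (fun v o => set (f (get v) o) v) (liftStmt ι get set g e q)
  | .load a q => .load (fun v => set (a (get v)) v) (liftStmt ι get set g e q)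
  | .branch f q₁ q₂ =>
    .branch (fun v => f (get v)) (liftStmt ι get set g e q₁) (liftStmt ι get set g e q₂)
  | .goto f => .goto fun v => g (f (get v))
  | .halt => e.elim .halt fun l => .goto fun _ => l

variable {ι : K → K'} (hι : Function.Injective ι) {get : σ' → σ} {set : σ → σ' → σ'}
  (hgs : ∀ a v, get (set a v) = a) (hss : ∀ a b v, set a (set b v) = set a v)
  (hsg : ∀ v, set (get v) v = v) (g : Λ → Λ') (e : Option Λ')

include hι hgs hss hsg in
-- The three laws for `get` and `set` say that the small state is a component of the large one:
-- successive writes collapse into a single `set` on the original `v`, so everything else in the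
-- state survives.
theorem stepAux_liftStmt (q : TM2.Stmt (fun k => Γ' (ι k)) Λ σ) (v : σ')
    (T : ∀ k, List (Γ' (ι k))) (S : ∀ k, List (Γ' k)) (hS : ∀ k, S (ι k) = T k) :
    ∃ S', TM2.stepAux (liftStmt ι get set g e q) v S =
        ⟨(TM2.stepAux q (get v) T).l.elim e fun l => some (g l),
          set (TM2.stepAux q (get v) T).var v, S'⟩ ∧
      (∀ k, S' (ι k) = (TM2.stepAux q (get v) T).stk k) ∧
      ∀ k', k' ∉ Set.range ι → S' k' = S k' := by
  have hupd : ∀ (T : ∀ k, List (Γ' (ι k))) (S : ∀ k, List (Γ' k)) (_ : ∀ k, S (ι k) = T k)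
      (k : K) (w : List (Γ' (ι k))),
      (∀ k₁, Function.update S (ι k) w (ι k₁) = Function.update T k w k₁) ∧
      ∀ k', k' ∉ Set.range ι → Function.update S (ι k) w k' = S k' := by
    intro T S hS k w
    refine ⟨fun k₁ => ?_, fun k' hk' => ?_⟩
    · by_cases h : k₁ = k
      · subst h; simp
      · rw [Function.update_of_ne h, Function.update_of_ne (fun h' => h (hι h')), hS]
    · exact Function.update_of_ne (fun h => hk' ⟨k, h.symm⟩) _ _
  induction q generalizing v T S with
  | push k f q ih =>
    obtain ⟨h₁, h₂⟩ := hupd T S hS k (f (get v) :: T k)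
    obtain ⟨S', hS', hr, hf⟩ := ih v _ _ h₁
    refine ⟨S', ?_, hr, fun k' hk' => (hf k' hk').trans (h₂ k' hk')⟩
    simp only [liftStmt, TM2.stepAux, hS]
    exact hS'
  | peek k f q ih =>
    obtain ⟨S', hS', hr, hf⟩ := ih (set (f (get v) (T k).head?) v) T S hS
    rw [hgs, hss] at hS'
    rw [hgs] at hr
    refine ⟨S', ?_, hr, hf⟩
    simp only [liftStmt, TM2.stepAux, hS]
    exact hS'
  | pop k f q ih =>
    obtain ⟨h₁, h₂⟩ := hupd T S hS k (T k).tail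
    obtain ⟨S', hS', hr, hf⟩ := ih (set (f (get v) (T k).head?) v) _ _ h₁
    rw [hgs, hss] at hS'
    rw [hgs] at hr
    refine ⟨S', ?_, hr, fun k' hk' => (hf k' hk').trans (h₂ k' hk')⟩
    simp only [liftStmt, TM2.stepAux, hS]
    exact hS'
  | load a q ih =>
    obtain ⟨S', hS', hr, hf⟩ := ih (set (a (get v)) v) T S hS
    rw [hgs, hss] at hS'
    rw [hgs] at hr
    exact ⟨S', hS', hr, hf⟩
  | branch f q₁ q₂ ih₁ ih₂ =>
    cases h : f (get v)
    · simpa [liftStmt, h] using ih₂ v T S hS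
    · simpa [liftStmt, h] using ih₁ v T S hS
  | goto f => exact ⟨S, by simp [liftStmt, hsg], by simpa using hS, fun _ _ => rfl⟩
  | halt =>
    refine ⟨S, ?_, by simpa using hS, fun _ _ => rfl⟩
    cases e <;> simp [liftStmt, hsg]

include hι hgs hss hsg in
-- `step` and `wrap` are kept abstract so that the simulation serves ordinary machines as well as
-- oracle machines, whose configurations also carry the answers.
theorem StepsTo.lift {C : Type} (step : C → Option C) (wrap : TM2.Cfg Γ' Λ' σ' → C)
    (m : Λ → TM2.Stmt (fun k => Γ' (ι k)) Λ σ)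
    (hstep : ∀ l v S, step (wrap ⟨some (g l), v, S⟩) =
      some (wrap (TM2.stepAux (liftStmt ι get set g e (m l)) v S)))
    {n : ℕ} {a b : TM2.Cfg (fun k => Γ' (ι k)) Λ σ} (h : StepsTo (TM2.step m) n a b)
    (v : σ') (hv : get v = a.var) (S : ∀ k, List (Γ' k)) (hS : ∀ k, S (ι k) = a.stk k) :
    ∃ S', StepsTo step n (wrap ⟨a.l.elim e fun l => some (g l), v, S⟩)
        (wrap ⟨b.l.elim e fun l => some (g l), set b.var v, S'⟩) ∧
      (∀ k, S' (ι k) = b.stk k) ∧ ∀ k', k' ∉ Set.range ι → S' k' = S k' := by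
  induction n generalizing a v S with
  | zero =>
    cases h
    refine ⟨S, ?_, hS, fun _ _ => rfl⟩
    rw [← hv, hsg]
    rfl
  | succ n ih =>
    obtain ⟨d, hd, h⟩ := h
    obtain ⟨_ | l, w, T⟩ := a
    · simp at hd
    · simp only [TM2.step, Option.some.injEq] at hd
      subst hd
      simp only at hv hS
      subst hv
      obtain ⟨S₁, h₁, hr, hf⟩ := stepAux_liftStmt hι hgs hss hsg g e (m l) v T S hS
      obtain ⟨S', h', hr', hf'⟩ := ih h _ (hgs _ v) S₁ hr
      refine ⟨S', ⟨_, hstep l v S, ?_⟩, hr', fun k' hk' => (hf' k' hk').trans (hf k' hk')⟩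
      rw [h₁]
      rw [hss] at h'
      exact h'

include hι hgs hss hsg in
theorem StepsTo.lift_run {C : Type} (step : C → Option C) (wrap : TM2.Cfg Γ' Λ' σ' → C)
    (m : Λ → TM2.Stmt (fun k => Γ' (ι k)) Λ σ)
    (hstep : ∀ l v S, step (wrap ⟨some (g l), v, S⟩) =
      some (wrap (TM2.stepAux (liftStmt ι get set g e (m l)) v S)))
    {n : ℕ} {l : Λ} {v : σ'} {w : σ} {T T' : ∀ k, List (Γ' (ι k))} {S : ∀ k, List (Γ' k)}
    (h : StepsTo (TM2.step m) n ⟨some l, get v, T⟩ ⟨none, w, T'⟩) (hS : ∀ k, S (ι k) = T k) :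
    ∃ S', StepsTo step n (wrap ⟨some (g l), v, S⟩) (wrap ⟨e, set w v, S'⟩) ∧
      (∀ k, S' (ι k) = T' k) ∧ ∀ k', (∀ k, ι k ≠ k') → S' k' = S k' := by
  obtain ⟨S', h₁, h₂, h₃⟩ := h.lift hι hgs hss hsg g e step wrap m hstep v rfl S hS
  exact ⟨S', h₁, h₂, fun k' hk' => h₃ k' fun ⟨k, hk⟩ => hk' k hk⟩

end Lift

/-! ### Emptying a stack symbol by symbol -/

/-- This covers erasing, moving and copying loops: `out k a` is what stack `k` receives when `a` is
popped. By `hreg` the register forgets earlier letters, so the final state does not depend on the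
word. The extra step is the one that finds the stack empty. -/
theorem StepsTo.drain {K Λ σ : Type} {Γ : K → Type}
    {step : TM2.Cfg Γ Λ σ → Option (TM2.Cfg Γ Λ σ)} {L : Λ} {next : Option Λ}
    {src : K}
    (out : ∀ k, Γ src → List (Γ k)) (reg : Option (Γ src) → σ → σ)
    (hreg : ∀ a b v, reg a (reg b v) = reg a v)
    (hnil : ∀ v S, S src = [] → step ⟨some L, v, S⟩ = some ⟨next, reg none v, S⟩)
    (hcons : ∀ v S a w, S src = a :: w → ∃ S',
      step ⟨some L, v, S⟩ = some ⟨some L, reg (some a) v, S'⟩ ∧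
      S' src = w ∧ ∀ k, k ≠ src → S' k = out k a ++ S k)
    (v : σ) (S : ∀ k, List (Γ k)) :
    ∃ S', StepsTo step ((S src).length + 1) ⟨some L, v, S⟩ ⟨next, reg none v, S'⟩ ∧
      S' src = [] ∧ ∀ k, k ≠ src → S' k = (S src).reverse.flatMap (out k) ++ S k := by
  induction h : S src generalizing v S with
  | nil => exact ⟨S, .single (hnil v S h), h, fun k _ => by simp⟩
  | cons a w ih =>
    obtain ⟨S₁, h₁, hs, hk⟩ := hcons v S a w h
    obtain ⟨S', h', hs', hk'⟩ := ih (reg (some a) v) S₁ hs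
    rw [hreg] at h'
    refine ⟨S', ⟨_, h₁, h'⟩, hs', fun k hne => ?_⟩
    rw [hk' k hne, hk k hne]
    simp

/-! ### Machines that halt without cleaning up -/

section Cleanup

variable {K : Type} [DecidableEq K] [Fintype K] {Γ : K → Type} {Λ σ : Type}

/-- Pop every stack in the list `ks` once, and record whether one of them was nonempty. -/
def popAll (ks : List K) (q : TM2.Stmt Γ Λ (σ × Bool)) : TM2.Stmt Γ Λ (σ × Bool) :=
  ks.foldr (fun k q => .pop k (fun v o => (v.1, v.2 || o.isSome)) q) q

omit [Fintype K] in
theorem stepAux_popAll (ks : List K) (hks : ks.Nodup) (q : TM2.Stmt Γ Λ (σ × Bool)) (v : σ × Bool)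
    (S : ∀ k, List (Γ k)) :
    TM2.stepAux (popAll ks q) v S =
      TM2.stepAux q (v.1, v.2 || ks.any fun k => (S k).head?.isSome)
        fun k => if k ∈ ks then (S k).tail else S k := by
  induction ks generalizing v S with
  | nil => simp [popAll]
  | cons k ks ih =>
    obtain ⟨hk, hks⟩ := List.nodup_cons.1 hks
    have := ih hks (v.1, v.2 || (S k).head?.isSome) (Function.update S k (S k).tail)
    simp only [popAll, List.foldr_cons, TM2.stepAux] at this ⊢
    rw [this]
    congr 1
    · congr 1
      rw [List.any_cons, Bool.or_assoc]
      congr 2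
      rw [Bool.eq_iff_iff, List.any_eq_true, List.any_eq_true]
      refine exists_congr fun x => and_congr_right fun hx => ?_
      rw [Function.update_of_ne (by rintro rfl; exact hk hx)]
    · funext k'
      by_cases h : k' = k
      · subst h; simp [hk]
      · simp [h]

variable (k₁ : K) (m : Λ → TM2.Stmt Γ Λ σ) (init : σ)

open Classical in
/-- The machine `m`, followed by a loop that empties all stacks but `k₁` and resets the internal
state. -/
noncomputable def cleanProgram : Option Λ → TM2.Stmt Γ (Option Λ) (σ × Bool)
  | some l => liftStmt (fun k => k) Prod.fst (fun a v => (a, v.2)) some (some none) (m l)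
  | none => popAll (Finset.univ.filter (· ≠ k₁)).toList
      (.branch Prod.snd (.load (fun _ => (init, false)) (.goto fun _ => none))
        (.load (fun _ => (init, false)) .halt))

/-- Each round shortens all stacks but `k₁` at once; at most `N` rounds find a letter, and one more
finds none. -/
theorem cleanProgram_loop (N : ℕ) (v : σ) (S : ∀ k, List (Γ k))
    (hS : ∀ k, k ≠ k₁ → (S k).length ≤ N) :
    ∃ n ≤ N + 1, StepsTo (TM2.step (cleanProgram k₁ m init)) n ⟨some none, (v, false), S⟩
      ⟨none, (init, false), Function.update (fun _ => []) k₁ (S k₁)⟩ := by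
  classical
  have key : ∀ v S, TM2.step (cleanProgram k₁ m init) ⟨some none, (v, false), S⟩ =
      some ⟨if ∃ k, k ≠ k₁ ∧ S k ≠ [] then some none else none, (init, false),
        fun k => if k ≠ k₁ then (S k).tail else S k⟩ := by
    intro v S
    simp only [TM2.step, cleanProgram, stepAux_popAll _ (Finset.nodup_toList _),
      Option.some.injEq, TM2.stepAux, Bool.false_or]
    have : ((Finset.univ.filter (· ≠ k₁)).toList.any fun k => (S k).head?.isSome) =
        decide (∃ k, k ≠ k₁ ∧ S k ≠ []) := by
      rw [Bool.eq_iff_iff, List.any_eq_true]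
      simp [List.isSome_head?]
    rw [this]
    by_cases h : ∃ k, k ≠ k₁ ∧ S k ≠ []
    · simp [h]
    · simp [h]
  have final : ∀ v S, (¬ ∃ k, k ≠ k₁ ∧ S k ≠ []) →
      StepsTo (TM2.step (cleanProgram k₁ m init)) 1 ⟨some none, (v, false), S⟩
        ⟨none, (init, false), Function.update (fun _ => []) k₁ (S k₁)⟩ := by
    intro v S h
    have hkey := key v S
    rw [if_neg h] at hkey
    push Not at h
    convert StepsTo.single hkey using 2
    funext k
    by_cases hk : k = k₁
    · subst hk; simp
    · simp [hk, h k hk]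
  induction N generalizing v S with
  | zero =>
    refine ⟨1, le_rfl, final v S ?_⟩
    rintro ⟨k, hk, hk'⟩
    exact absurd (List.length_eq_zero_iff.1 (Nat.le_zero.1 (hS k hk))) hk'
  | succ N ih =>
    by_cases h : ∃ k, k ≠ k₁ ∧ S k ≠ []
    · have hkey := key v S
      rw [if_pos h] at hkey
      obtain ⟨n, hn, h'⟩ := ih init (fun k => if k ≠ k₁ then (S k).tail else S k)
        (fun k hk => by have := hS k hk; simp [hk]; omega)
      refine ⟨n + 1, by omega, _, hkey, ?_⟩
      simpa using h'
    · exact ⟨1, by omega, final v S h⟩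

variable {k₁ m init}

theorem StepsTo.clean {main : Λ} {n N : ℕ} {S₀ S : ∀ k, List (Γ k)} {v : σ}
    (h : StepsTo (TM2.step m) n ⟨some main, init, S₀⟩ ⟨none, v, S⟩)
    (hS : ∀ k, (S k).length ≤ N) :
    ∃ n' ≤ n + (N + 1), StepsTo (TM2.step (cleanProgram k₁ m init)) n'
      ⟨some (some main), (init, false), S₀⟩
      ⟨none, (init, false), Function.update (fun _ => []) k₁ (S k₁)⟩ := by
  obtain ⟨S', h₁, hr, -⟩ := h.lift (ι := fun k => k) (get := Prod.fst)
    (set := fun a (v : σ × Bool) => (a, v.2)) Function.injective_id (fun _ _ => rfl)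
    (fun _ _ _ => rfl) (fun _ => rfl) some (some none) (TM2.step (cleanProgram k₁ m init)) id m
    (fun l v S => rfl) (init, false) rfl S₀ (fun _ => rfl)
  obtain rfl : S' = S := funext hr
  obtain ⟨n', hn', h₂⟩ := cleanProgram_loop k₁ m init N v S' (fun k _ => hS k)
  exact ⟨n + n', by omega, h₁.trans h₂⟩

end Cleanup

theorem initList_eq (M : FinTM2) (s : List (M.Γ M.k₀)) :
    initList M s = ⟨some M.main, M.initialState, Function.update (fun _ => []) M.k₀ s⟩ := by
  unfold initList
  congr 1
  funext k
  by_cases h : k = M.k₀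
  · subst h; simp
  · simp [h]

theorem haltList_eq (M : FinTM2) (s : List (M.Γ M.k₁)) :
    haltList M s = ⟨none, M.initialState, Function.update (fun _ => []) M.k₁ s⟩ := by
  unfold haltList
  congr 1
  funext k
  by_cases h : k = M.k₁
  · subst h; simp
  · simp [h]

theorem eval_mono (p : Polynomial ℕ) {m n : ℕ} (h : m ≤ n) : p.eval m ≤ p.eval n := by
  rw [Polynomial.eval_eq_sum, Polynomial.eval_eq_sum]
  exact Finset.sum_le_sum fun i _ => Nat.mul_le_mul_left _ (Nat.pow_le_pow_left h i)

theorem length_update_le {K : Type} [DecidableEq K] {Γ : K → Type} (k₀ : K) (w : List (Γ k₀))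
    (k : K) : (Function.update (fun k => ([] : List (Γ k))) k₀ w k).length ≤ w.length := by
  by_cases h : k = k₀
  · subst h; simp
  · simp [h]

/-! ### Polynomial time in terms of runs. -/

section PolyTime

variable {α β αΓ βΓ : Type} {ea : α → List αΓ} {eb : β → List βΓ} {f : α → β}

/-- A function is computable in polynomial time if some machine leaves its value on one of its
stacks, in whatever state the other stacks and the internal state are on halting. -/
theorem polyTime_of_run {K : Type} [DecidableEq K] [Fintype K] {Γ : K → Type} {Λ σ : Type}
    [Fintype Λ] [Fintype σ] (k₀ k₁ : K) [Fintype (Γ k₀)] (m : Λ → TM2.Stmt Γ Λ σ) (main : Λ)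
    (init : σ) (i : Γ k₀ ≃ αΓ) (o : Γ k₁ ≃ βΓ) (p : Polynomial ℕ)
    (h : ∀ a, ∃ n v S, n ≤ p.eval (ea a).length ∧
      StepsTo (TM2.step m) n
        ⟨some main, init, Function.update (fun _ => []) k₀ ((ea a).map i.symm)⟩ ⟨none, v, S⟩ ∧
      S k₁ = (eb (f a)).map o.symm) :
    PolyTime ea eb f := by
  obtain ⟨c, hc⟩ := program_growth m
  -- An output counts only if the machine halts in its initial internal state with all other stacks
  -- empty, whence the cleaning loop.
  let M : FinTM2 :=
    { k₀ := k₀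
      k₁ := k₁
      Γ := Γ
      Λ := Option Λ
      main := some main
      σ := σ × Bool
      initialState := (init, false)
      m := cleanProgram k₁ m init }
  -- After at most `p` steps the stacks have length at most `X + c * p`, which bounds the cleaning
  -- rounds up to the final one.
  refine ⟨⟨⟨M, i, o⟩,
    p + (Polynomial.X + Polynomial.C c * p + 1), fun a => Classical.choice ?_⟩⟩
  unfold TM2OutputsInTime
  rw [Option.map_some, evalsToInTime_iff, initList_eq, haltList_eq]
  obtain ⟨n, v, S, hn, hrun, hS⟩ := h a
  obtain ⟨n', hn', h'⟩ := hrun.clean (k₁ := k₁) (N := (ea a).length + c * p.eval (ea a).length)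
    fun k => (hrun.growth hc k).trans (by
      refine add_le_add ((length_update_le _ _ _).trans (by simp)) (Nat.mul_le_mul_left _ hn))
  refine ⟨n', hn'.trans (by simp; omega), ?_⟩
  rw [hS] at h'
  exact h'

theorem PolyTime.exists_run (h : PolyTime ea eb f) :
    ∃ (M : FinTM2) (i : M.Γ M.k₀ ≃ αΓ) (o : M.Γ M.k₁ ≃ βΓ) (p : Polynomial ℕ), ∀ a,
      ∃ n ≤ p.eval (ea a).length, StepsTo (TM2.step M.m) n
        ⟨some M.main, M.initialState, Function.update (fun _ => []) M.k₀ ((ea a).map i.symm)⟩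
        ⟨none, M.initialState, Function.update (fun _ => []) M.k₁ ((eb (f a)).map o.symm)⟩ := by
  obtain ⟨⟨M, i, o⟩, p, hp⟩ := h
  refine ⟨M, i, o, p, fun a => ?_⟩
  have := Nonempty.intro (hp a)
  unfold TM2OutputsInTime at this
  rw [Option.map_some, evalsToInTime_iff, initList_eq, haltList_eq] at this
  exact this

theorem PolyTime.exists_length_le (h : PolyTime ea eb f) :
    ∃ p : Polynomial ℕ, ∀ a, (eb (f a)).length ≤ p.eval (ea a).length := by
  obtain ⟨M, i, o, p, hp⟩ := h.exists_run
  have := M.ΛFin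
  obtain ⟨c, hc⟩ := program_growth M.m
  refine ⟨Polynomial.X + Polynomial.C c * p, fun a => ?_⟩
  obtain ⟨n, hn, hrun⟩ := hp a
  have h₁ := hrun.growth hc M.k₁
  have h₂ := length_update_le M.k₀ ((ea a).map i.symm) M.k₁
  have h₃ := Nat.mul_le_mul_left c hn
  simp only [Function.update_self, List.length_map] at h₁ h₂
  simp only [Polynomial.eval_add, Polynomial.eval_X, Polynomial.eval_mul, Polynomial.eval_C]
  omega

end PolyTime

/-! ### Finite-state transducers -/

section Transducer

variable {τ α β : Type} (δ : τ → α → τ) (out : τ → α → Option β) (fin : τ → Option β)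

/-- The output of a finite-state transducer that reads a word from left to right, writes at most
one letter per step, and at most one more at the end. -/
def transduce : τ → List α → List β
  | s, [] => (fin s).toList
  | s, a :: w => (out s a).toList ++ transduce (δ s a) w

end Transducer

section TransducerProgram

variable {τ : Type} {Γ : Bool → Type} (δ : τ → Γ false → τ) (out : τ → Γ false → Option (Γ true))
  (fin : τ → Option (Γ true))

/-- The one-label machine running a transducer: it reads the stack `false` and writes to the stack
`true`. -/
def transducerProgram [Inhabited (Γ true)] :
    Unit → TM2.Stmt Γ Unit (τ × Option (Γ true) × Bool) := fun _ =>
  .pop false (fun v o => o.elim (v.1, fin v.1, true) fun a => (δ v.1 a, out v.1 a, false))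
    (.branch (fun v => v.2.1.isSome)
      (.push true (fun v => v.2.1.getD default)
        (.branch (fun v => v.2.2) .halt (.goto fun _ => ())))
      (.branch (fun v => v.2.2) .halt (.goto fun _ => ())))

variable {δ out fin}

theorem transducerProgram_steps [Inhabited (Γ true)] (w : List (Γ false))
    (v : τ × Option (Γ true) × Bool) (S : ∀ b, List (Γ b)) (hS : S false = w) :
    ∃ v' S', StepsTo (TM2.step (transducerProgram δ out fin)) (w.length + 1) ⟨some (), v, S⟩
      ⟨none, v', S'⟩ ∧ S' true = (transduce δ out fin v.1 w).reverse ++ S true := by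
  induction w generalizing v S with
  | nil =>
    cases h : fin v.1 with
    | none =>
      exact ⟨_, _, .single (by simp [transducerProgram, hS, h]; exact ⟨rfl, rfl⟩),
        by simp [transduce, h]⟩
    | some b =>
      exact ⟨_, _, .single (by simp [transducerProgram, hS, h]; exact ⟨rfl, rfl⟩),
        by simp [transduce, h]⟩
  | cons a w ih =>
    cases h : out v.1 a with
    | none =>
      obtain ⟨v', S', hr, ho⟩ := ih (δ v.1 a, none, false) (Function.update S false w) (by simp)
      exact ⟨v', S', ⟨_, by simp [transducerProgram, hS, h], hr⟩, by simp [ho, transduce, h]⟩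
    | some b =>
      obtain ⟨v', S', hr, ho⟩ := ih (δ v.1 a, some b, false)
        (Function.update (Function.update S false w) true (b :: S true)) (by simp)
      exact ⟨v', S', ⟨_, by simp [transducerProgram, hS, h], hr⟩, by simp [ho, transduce, h]⟩

theorem polyTime_reverse_transduce_aux [Fintype τ] [Fintype (Γ false)] [Fintype (Γ true)]
    [Inhabited (Γ true)] (s : τ) :
    PolyTime id id fun w : List (Γ false) => (transduce δ out fin s w).reverse := by
  refine polyTime_of_run false true (transducerProgram δ out fin) () (s, none, false)
    (Equiv.refl _) (Equiv.refl _) (Polynomial.X + 1) fun w => ?_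
  obtain ⟨v', S', h, h'⟩ := transducerProgram_steps (δ := δ) (out := out) (fin := fin) w
    (s, none, false) (Function.update (fun _ => []) false w) (by simp)
  exact ⟨w.length + 1, v', S', by simp, by simpa using h, by simpa using h'⟩

end TransducerProgram

/-- Letters are pushed as they are produced, so the first one ends at the bottom.
`polyTime_transduce` undoes the reversal by a second pass that copies its input. -/
theorem polyTime_reverse_transduce {τ α β : Type} [hτ : Fintype τ] [hα : Fintype α]
    [hβ : Fintype β] [hβ' : Inhabited β] (δ : τ → α → τ) (out : τ → α → Option β)
    (fin : τ → Option β) (s : τ) :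
    PolyTime id id fun w : List α => (transduce δ out fin s w).reverse :=
  @polyTime_reverse_transduce_aux τ (fun b => bif b then β else α) δ out fin hτ hα hβ hβ' s

/-! ### Composition -/

section Comp

variable {K₁ K₂ Λ₁ Λ₂ σ₁ σ₂ : Type} [DecidableEq K₁] [DecidableEq K₂] {Γ : K₁ ⊕ (K₂ ⊕ Unit) → Type}
  (m₁ : Λ₁ → TM2.Stmt (fun k => Γ (.inl k)) Λ₁ σ₁)
  (m₂ : Λ₂ → TM2.Stmt (fun k => Γ (.inr (.inl k))) Λ₂ σ₂)
  (main₂ : Λ₂) (k₁ : K₁) (k₂ : K₂) (o : Γ (.inl k₁) → Γ (.inr (.inr ())))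
  (i : Γ (.inr (.inr ())) → Γ (.inr (.inl k₂)))

/-- Run `m₁`, transfer its output stack `k₁` to the input stack `k₂` of `m₂`, and run `m₂`. -/
def compProgram [Inhabited (Γ (.inr (.inr ())))] : Λ₁ ⊕ (Λ₂ ⊕ Bool) →
    TM2.Stmt Γ (Λ₁ ⊕ (Λ₂ ⊕ Bool)) (σ₁ × σ₂ × Option (Γ (.inr (.inr ()))))
  | .inl l => liftStmt Sum.inl Prod.fst (fun a v => (a, v.2)) Sum.inl
      (some (.inr (.inr false))) (m₁ l)
  | .inr (.inl l) => liftStmt (fun k => .inr (.inl k)) (fun v => v.2.1)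
      (fun a v => (v.1, a, v.2.2)) (fun l => .inr (.inl l)) none (m₂ l)
  | .inr (.inr false) =>
    .pop (.inl k₁) (fun v x => (v.1, v.2.1, x.map o))
      (.branch (fun v => v.2.2.isNone) (.goto fun _ => .inr (.inr true))
        (.push (.inr (.inr ())) (fun v => v.2.2.getD default)
          (.goto fun _ => .inr (.inr false))))
  | .inr (.inr true) =>
    .pop (.inr (.inr ())) (fun v x => (v.1, v.2.1, x))
      (.branch (fun v => v.2.2.isNone) (.goto fun _ => .inr (.inl main₂))
        (.push (.inr (.inl k₂)) (fun v => i (v.2.2.getD default))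
          (.goto fun _ => .inr (.inr true))))

variable {m₁ m₂ main₂ k₁ k₂ o i}

/-- Moving a word between stacks reverses it, so the output of `m₁` travels through the auxiliary
stack; each of the two transfers takes `N + 1` steps. -/
theorem compProgram_steps [Inhabited (Γ (.inr (.inr ())))] {n₁ n₂ : ℕ} {k₀ : K₁} {k₃ : K₂}
    {main₁ : Λ₁} {w₁ : List (Γ (.inl k₀))} {w : List (Γ (.inl k₁))}
    {w₂ : List (Γ (.inr (.inl k₃)))} {u₁ v₁ : σ₁} {u₂ v₂ : σ₂} {N : ℕ} (hw : w.length = N)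
    (h₁ : StepsTo (TM2.step m₁) n₁
      ⟨some main₁, u₁, Function.update (fun _ => []) k₀ w₁⟩
      ⟨none, v₁, Function.update (fun _ => []) k₁ w⟩)
    (h₂ : StepsTo (TM2.step m₂) n₂
      ⟨some main₂, u₂, Function.update (fun _ => []) k₂ (w.map fun a => i (o a))⟩
      ⟨none, v₂, Function.update (fun _ => []) k₃ w₂⟩) :
    ∃ v S, StepsTo (TM2.step (compProgram m₁ m₂ main₂ k₁ k₂ o i))
        (n₁ + (N + 1 + (N + 1 + n₂)))
        ⟨some (.inl main₁), (u₁, u₂, none), Function.update (fun _ => []) (.inl k₀) w₁⟩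
        ⟨none, v, S⟩ ∧
      S (.inr (.inl k₃)) = w₂ := by
  subst hw
  set step := TM2.step (compProgram m₁ m₂ main₂ k₁ k₂ o i) with hstep
  obtain ⟨S₁, r₁, hS₁, hS₁'⟩ := StepsTo.lift_run (ι := Sum.inl) (get := Prod.fst)
    (set := fun a v => (a, v.2)) Sum.inl_injective (fun _ _ => rfl)
    (fun _ _ _ => rfl) (fun _ => rfl) Sum.inl (some (.inr (.inr false)))
    step id m₁ (fun _ _ _ => rfl) (v := (u₁, u₂, none))
    (S := Function.update (fun _ => []) (.inl k₀) w₁) h₁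
    (fun k => by
      by_cases h : k = k₀
      · subst h; simp
      · simp [h])
  obtain ⟨S₂, r₂, hS₂, hS₂'⟩ := StepsTo.drain (step := step)
    (L := .inr (.inr false)) (next := some (.inr (.inr true))) (src := .inl k₁)
    (Function.update (fun _ _ => []) (.inr (.inr ())) fun a => [o a])
    (fun x v => (v.1, v.2.1, x.map o)) (fun _ _ _ => rfl)
    (fun v S h => by simp [hstep, compProgram, h])
    (fun v S a w h => ⟨_, by simp [hstep, compProgram, h]; rfl, by simp, fun k hk => by
      by_cases h : k = .inr (.inr ())
      · subst h; simp
      · simp [h, hk]⟩)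
    (v₁, u₂, none) S₁
  obtain ⟨S₃, r₃, hS₃, hS₃'⟩ := StepsTo.drain (step := step)
    (L := .inr (.inr true)) (next := some (.inr (.inl main₂))) (src := .inr (.inr ()))
    (Function.update (fun _ _ => []) (.inr (.inl k₂)) fun a => [i a])
    (fun x v => (v.1, v.2.1, x)) (fun _ _ _ => rfl)
    (fun v S h => by simp [hstep, compProgram, h])
    (fun v S a w h => ⟨_, by simp [hstep, compProgram, h]; rfl, by simp, fun k hk => by
      by_cases h : k = .inr (.inl k₂)
      · subst h; simp
      · simp [h, hk]⟩)
    (v₁, u₂, none) S₂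
  have e₁ : S₁ (.inl k₁) = w := by simp [hS₁]
  have e₂ : S₂ (.inr (.inr ())) = (w.map o).reverse := by
    rw [hS₂' _ (by simp), hS₁' (.inr (.inr ())) (by simp), e₁]
    simp [← List.map_eq_flatMap]
  have e₃ : ∀ k, S₃ (.inr (.inl k)) =
      (Function.update (fun _ => []) k₂ (w.map fun a => i (o a)) :
        ∀ k, List (Γ (.inr (.inl k)))) k := by
    intro k
    rw [hS₃' _ (by simp), hS₂' (.inr (.inl k)) (by simp), hS₁' (.inr (.inl k)) (by simp), e₂]
    by_cases h : k = k₂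
    · subst h
      simp [← List.map_eq_flatMap, Function.comp_def]
    · simp [h]
  obtain ⟨S₄, r₄, hS₄, -⟩ := StepsTo.lift_run (ι := fun k => .inr (.inl k))
    (get := fun v => v.2.1) (set := fun a v => (v.1, a, v.2.2))
    (Sum.inr_injective.comp Sum.inl_injective) (fun _ _ => rfl)
    (fun _ _ _ => rfl) (fun _ => rfl) (fun l => .inr (.inl l)) none
    step id m₂ (fun _ _ _ => rfl) (v := (v₁, u₂, none)) h₂ e₃
  rw [e₁] at r₂
  rw [e₂] at r₃
  refine ⟨_, S₄, r₁.trans (r₂.trans (.trans ?_ r₄)), by simp [hS₄]⟩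
  simpa using r₃

end Comp

theorem PolyTime.comp {α β γ αΓ βΓ γΓ : Type} [Inhabited βΓ] {ea : α → List αΓ}
    {eb : β → List βΓ} {ec : γ → List γΓ} {g : β → γ} {f : α → β} (hg : PolyTime eb ec g)
    (hf : PolyTime ea eb f) : PolyTime ea ec fun a => g (f a) := by
  obtain ⟨q, hq⟩ := hf.exists_length_le
  obtain ⟨M₁, i₁, o₁, p₁, h₁⟩ := hf.exists_run
  obtain ⟨M₂, i₂, o₂, p₂, h₂⟩ := hg.exists_run
  have := M₁.kFin
  have := M₂.kFin
  have := M₁.ΛFin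
  have := M₂.ΛFin
  have := M₁.σFin
  have := M₂.σFin
  have : Fintype (M₁.Γ M₁.k₀) := M₁.Γk₀Fin
  have : Fintype βΓ := @Fintype.ofEquiv _ _ M₂.Γk₀Fin i₂
  let Γ : M₁.K ⊕ (M₂.K ⊕ Unit) → Type := Sum.elim M₁.Γ (Sum.elim M₂.Γ fun _ => βΓ)
  have : Inhabited (Γ (.inr (.inr ()))) := ⟨(default : βΓ)⟩
  have : Fintype (Γ (.inr (.inr ()))) := @Fintype.ofEquiv βΓ _ ‹_› (Equiv.refl βΓ)
  have : Fintype (Γ (.inl M₁.k₀)) := M₁.Γk₀Fin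
  refine polyTime_of_run (Γ := Γ) (.inl M₁.k₀) (.inr (.inl M₂.k₁))
    (compProgram (Γ := Γ) M₁.m M₂.m M₂.main M₁.k₁ M₂.k₀ o₁ i₂.symm) (.inl M₁.main)
    (M₁.initialState, M₂.initialState, none) i₁ o₂
    (p₁ + (q + 1 + (q + 1 + p₂.comp q))) fun a => ?_
  obtain ⟨n₁, hn₁, r₁⟩ := h₁ a
  obtain ⟨n₂, hn₂, r₂⟩ := h₂ (f a)
  have hp := eval_mono p₂ (hq a)
  have e : (eb (f a)).map i₂.symm = ((eb (f a)).map o₁.symm).map fun x => i₂.symm (o₁ x) := by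
    simp [Function.comp_def]
  rw [e] at r₂
  obtain ⟨v, S, r, hS⟩ := compProgram_steps (Γ := Γ) (o := o₁) (i := i₂.symm)
    (List.length_map _) r₁ r₂
  refine ⟨_, v, S, ?_, r, hS⟩
  have hq := hq a
  simp only [Polynomial.eval_add, Polynomial.eval_comp, Polynomial.eval_one]
  omega

/-! ### Running two machines on the same input -/

section Pair

variable {K₁ K₂ Λ₁ Λ₂ σ₁ σ₂ : Type} [DecidableEq K₁] [DecidableEq K₂] {Γ : K₁ ⊕ (K₂ ⊕ Bool) → Type}
  (m₁ : Λ₁ → TM2.Stmt (fun k => Γ (.inl k)) Λ₁ σ₁)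
  (m₂ : Λ₂ → TM2.Stmt (fun k => Γ (.inr (.inl k))) Λ₂ σ₂)
  (main₁ : Λ₁) (main₂ : Λ₂) (k₁ k₁' : K₁) (k₂ k₂' : K₂)
  (f : Γ (.inl k₁) → Γ (.inr (.inr false)))
  (g₁ : Γ (.inr (.inr false)) → Γ (.inl k₁)) (g₂ : Γ (.inr (.inr false)) → Γ (.inr (.inl k₂)))
  (p₁ : Γ (.inl k₁') → Γ (.inr (.inr true))) (p₂ : Γ (.inr (.inl k₂')) → Γ (.inr (.inr true)))

/-- Copy the input to the input stacks of both machines, run them one after the other, and collect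
their outputs. -/
def pairProgram [Inhabited (Γ (.inr (.inr false)))] [Inhabited (Γ (.inr (.inr true)))] :
    Λ₁ ⊕ (Λ₂ ⊕ Fin 4) → TM2.Stmt Γ (Λ₁ ⊕ (Λ₂ ⊕ Fin 4))
      (σ₁ × σ₂ × Option (Γ (.inr (.inr false))) × Option (Γ (.inr (.inr true))))
  | .inl l => liftStmt Sum.inl Prod.fst (fun a v => (a, v.2)) Sum.inl
      (some (.inr (.inl main₂))) (m₁ l)
  | .inr (.inl l) => liftStmt (fun k => .inr (.inl k)) (fun v => v.2.1)
      (fun a v => (v.1, a, v.2.2)) (fun l => .inr (.inl l)) (some (.inr (.inr 2))) (m₂ l)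
  | .inr (.inr 0) =>
    .pop (.inl k₁) (fun v x => (v.1, v.2.1, x.map f, v.2.2.2))
      (.branch (fun v => v.2.2.1.isNone) (.goto fun _ => .inr (.inr 1))
        (.push (.inr (.inr false)) (fun v => v.2.2.1.getD default)
          (.goto fun _ => .inr (.inr 0))))
  | .inr (.inr 1) =>
    .pop (.inr (.inr false)) (fun v x => (v.1, v.2.1, x, v.2.2.2))
      (.branch (fun v => v.2.2.1.isNone) (.goto fun _ => .inl main₁)
        (.push (.inl k₁) (fun v => g₁ (v.2.2.1.getD default))
          (.push (.inr (.inl k₂)) (fun v => g₂ (v.2.2.1.getD default))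
            (.goto fun _ => .inr (.inr 1)))))
  | .inr (.inr 2) =>
    .pop (.inl k₁') (fun v x => (v.1, v.2.1, v.2.2.1, x.map p₁))
      (.branch (fun v => v.2.2.2.isNone) (.goto fun _ => .inr (.inr 3))
        (.push (.inr (.inr true)) (fun v => v.2.2.2.getD default)
          (.goto fun _ => .inr (.inr 2))))
  | .inr (.inr 3) =>
    .pop (.inr (.inl k₂')) (fun v x => (v.1, v.2.1, v.2.2.1, x.map p₂))
      (.branch (fun v => v.2.2.2.isNone) .halt
        (.push (.inr (.inr true)) (fun v => v.2.2.2.getD default)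
          (.goto fun _ => .inr (.inr 3))))

variable {m₁ m₂ main₁ main₂ k₁ k₁' k₂ k₂' f g₁ g₂ p₁ p₂}

/-- The input is moved to an auxiliary stack and from there back to both input stacks, so each
machine finds its own initial configuration. The outputs are pushed one after the other, hence the
reversal. -/
theorem pairProgram_steps [Inhabited (Γ (.inr (.inr false)))] [Inhabited (Γ (.inr (.inr true)))]
    {n₁ n₂ N N₁ N₂ : ℕ} {w : List (Γ (.inl k₁))} {w₁ : List (Γ (.inl k₁'))}
    {w₂ : List (Γ (.inr (.inl k₂')))} {u₁ v₁ : σ₁} {u₂ v₂ : σ₂} (hw : w.length = N)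
    (hw₁ : w₁.length = N₁) (hw₂ : w₂.length = N₂) (hg₁ : ∀ a, g₁ (f a) = a)
    (h₁ : StepsTo (TM2.step m₁) n₁
      ⟨some main₁, u₁, Function.update (fun _ => []) k₁ w⟩
      ⟨none, v₁, Function.update (fun _ => []) k₁' w₁⟩)
    (h₂ : StepsTo (TM2.step m₂) n₂
      ⟨some main₂, u₂, Function.update (fun _ => []) k₂ (w.map fun a => g₂ (f a))⟩
      ⟨none, v₂, Function.update (fun _ => []) k₂' w₂⟩) :
    ∃ v S, StepsTo (TM2.step (pairProgram m₁ m₂ main₁ main₂ k₁ k₁' k₂ k₂' f g₁ g₂ p₁ p₂))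
        (N + 1 + (N + 1 + (n₁ + (n₂ + (N₁ + 1 + (N₂ + 1))))))
        ⟨some (.inr (.inr 0)), (u₁, u₂, none, none), Function.update (fun _ => []) (.inl k₁) w⟩
        ⟨none, v, S⟩ ∧
      S (.inr (.inr true)) = (w₁.map p₁ ++ w₂.map p₂).reverse := by
  subst hw hw₁ hw₂
  set step := TM2.step (pairProgram m₁ m₂ main₁ main₂ k₁ k₁' k₂ k₂' f g₁ g₂ p₁ p₂) with hstep
  obtain ⟨S₁, r₁, hS₁, hS₁'⟩ := StepsTo.drain (step := step)
    (L := .inr (.inr 0)) (next := some (.inr (.inr 1))) (src := .inl k₁)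
    (Function.update (fun _ _ => []) (.inr (.inr false)) fun a => [f a])
    (fun x v => (v.1, v.2.1, x.map f, v.2.2.2)) (fun _ _ _ => rfl)
    (fun v S h => by simp [hstep, pairProgram, h])
    (fun v S a w h => ⟨_, by simp [hstep, pairProgram, h]; rfl, by simp, fun k hk => by
      by_cases h : k = .inr (.inr false)
      · subst h; simp
      · simp [h, hk]⟩)
    (u₁, u₂, none, none) (Function.update (fun _ => []) (.inl k₁) w)
  obtain ⟨S₂, r₂, hS₂, hS₂'⟩ := StepsTo.drain (step := step)
    (L := .inr (.inr 1)) (next := some (.inl main₁)) (src := .inr (.inr false))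
    (Function.update (Function.update (fun _ _ => []) (.inl k₁) fun a => [g₁ a])
      (.inr (.inl k₂)) fun a => [g₂ a])
    (fun x v => (v.1, v.2.1, x, v.2.2.2)) (fun _ _ _ => rfl)
    (fun v S h => by simp [hstep, pairProgram, h])
    (fun v S a w h => ⟨_, by simp [hstep, pairProgram, h]; rfl, by simp, fun k hk => by
      by_cases h : k = .inr (.inl k₂)
      · subst h; simp
      by_cases h' : k = .inl k₁
      · subst h'; simp
      · simp [h, h', hk]⟩)
    (u₁, u₂, none, none) S₁
  have e₁ : S₁ (.inr (.inr false)) = (w.map f).reverse := by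
    rw [hS₁' _ (by simp)]
    simp [← List.map_eq_flatMap]
  have e₂ : ∀ k, S₂ (.inl k) =
      (Function.update (fun _ => []) k₁ w : ∀ k, List (Γ (.inl k))) k := by
    intro k
    rw [hS₂' _ (by simp), e₁]
    by_cases h : k = k₁
    · subst h
      simp [hS₁, ← List.map_eq_flatMap, Function.comp_def, hg₁]
    · rw [hS₁' _ (by simpa using h)]
      simp [h]
  have e₂' : ∀ k, S₂ (.inr (.inl k)) =
      (Function.update (fun _ => []) k₂ (w.map fun a => g₂ (f a)) :
        ∀ k, List (Γ (.inr (.inl k)))) k := by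
    intro k
    rw [hS₂' _ (by simp), e₁, hS₁' _ (by simp)]
    by_cases h : k = k₂
    · subst h
      simp [← List.map_eq_flatMap, Function.comp_def]
    · simp [h]
  obtain ⟨S₃, r₃, hS₃, hS₃'⟩ := StepsTo.lift_run (ι := Sum.inl) (get := Prod.fst)
    (set := fun a v => (a, v.2)) Sum.inl_injective (fun _ _ => rfl)
    (fun _ _ _ => rfl) (fun _ => rfl) Sum.inl (some (.inr (.inl main₂)))
    step id m₁ (fun _ _ _ => rfl) (v := (u₁, u₂, none, none)) h₁ e₂
  obtain ⟨S₄, r₄, hS₄, hS₄'⟩ := StepsTo.lift_run (ι := fun k => .inr (.inl k))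
    (get := fun v => v.2.1) (set := fun a v => (v.1, a, v.2.2))
    (Sum.inr_injective.comp Sum.inl_injective) (fun _ _ => rfl)
    (fun _ _ _ => rfl) (fun _ => rfl) (fun l => .inr (.inl l)) (some (.inr (.inr 2)))
    step id m₂ (fun _ _ _ => rfl) (v := (v₁, u₂, none, none)) (S := S₃) h₂
    (fun k => by rw [hS₃' _ (by simp), e₂'])
  obtain ⟨S₅, r₅, hS₅, hS₅'⟩ := StepsTo.drain (step := step)
    (L := .inr (.inr 2)) (next := some (.inr (.inr 3))) (src := .inl k₁')
    (Function.update (fun _ _ => []) (.inr (.inr true)) fun a => [p₁ a])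
    (fun x v => (v.1, v.2.1, v.2.2.1, x.map p₁)) (fun _ _ _ => rfl)
    (fun v S h => by simp [hstep, pairProgram, h])
    (fun v S a w h => ⟨_, by simp [hstep, pairProgram, h]; rfl, by simp, fun k hk => by
      by_cases h : k = .inr (.inr true)
      · subst h; simp
      · simp [h, hk]⟩)
    (v₁, v₂, none, none) S₄
  obtain ⟨S₆, r₆, hS₆, hS₆'⟩ := StepsTo.drain (step := step)
    (L := .inr (.inr 3)) (next := none) (src := .inr (.inl k₂'))
    (Function.update (fun _ _ => []) (.inr (.inr true)) fun a => [p₂ a])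
    (fun x v => (v.1, v.2.1, v.2.2.1, x.map p₂)) (fun _ _ _ => rfl)
    (fun v S h => by simp [hstep, pairProgram, h])
    (fun v S a w h => ⟨_, by simp [hstep, pairProgram, h]; rfl, by simp, fun k hk => by
      by_cases h : k = .inr (.inr true)
      · subst h; simp
      · simp [h, hk]⟩)
    (v₁, v₂, none, none) S₅
  have e₄ : S₄ (.inl k₁') = w₁ := by rw [hS₄' _ (by simp), hS₃]; simp
  have e₄' : S₄ (.inr (.inr true)) = [] := by
    rw [hS₄' _ (by simp), hS₃' _ (by simp), hS₂' _ (by simp), hS₁' (.inr (.inr true)) (by simp)]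
    simp
  have e₅ : S₅ (.inr (.inl k₂')) = w₂ := by
    rw [hS₅' _ (by simp), hS₄]
    simp
  simp only [Function.update_self] at r₁
  rw [e₁, List.length_reverse, List.length_map] at r₂
  rw [e₄] at r₅
  rw [e₅] at r₆
  refine ⟨_, S₆, r₁.trans (r₂.trans (r₃.trans (r₄.trans (r₅.trans r₆)))), ?_⟩
  rw [hS₆' _ (by simp), e₅, hS₅' _ (by simp), e₄, e₄']
  simp [← List.map_eq_flatMap]

end Pair

/-! ### Transducers and pairing of outputs. -/

section Algebra

variable {α αΓ : Type} {ea : α → List αΓ}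

/-- A finite-state transducer runs in polynomial time. -/
theorem polyTime_transduce {τ α β : Type} [Fintype τ] [Fintype α] [Fintype β] [Inhabited β]
    (δ : τ → α → τ) (out : τ → α → Option β) (fin : τ → Option β) (s : τ) :
    PolyTime id id fun w : List α => transduce δ out fin s w := by
  have h : ∀ w : List β, (transduce (fun (_ : Unit) (_ : β) => ()) (fun _ => some) (fun _ => none)
      () w) = w := fun w => by
    induction w with
    | nil => rfl
    | cons a w ih => simp [transduce, ih]
  have := (polyTime_reverse_transduce (fun (_ : Unit) (_ : β) => ()) (fun _ => some)
    (fun _ => none) ()).comp (polyTime_reverse_transduce δ out fin s)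
  simpa [h] using this

theorem polyTime_reverse {β : Type} [Fintype β] [Inhabited β] :
    PolyTime id id (List.reverse : List β → List β) := by
  have h : ∀ w : List β, (transduce (fun (_ : Unit) (_ : β) => ()) (fun _ => some) (fun _ => none)
      () w) = w := fun w => by
    induction w with
    | nil => rfl
    | cons a w ih => simp [transduce, ih]
  simpa [h] using polyTime_reverse_transduce (fun (_ : Unit) (_ : β) => ()) (fun _ => some)
    (fun _ => none) ()

/-- Once two results stand in one word over disjoint alphabets, a finite transducer can process them
jointly; concatenation, case distinction and pairs of words are obtained this way. -/
theorem PolyTime.pair {β γ : Type} [Fintype β] [Fintype γ] [Inhabited β] [Inhabited αΓ]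
    {F : α → List β} {G : α → List γ} (hF : PolyTime ea id F) (hG : PolyTime ea id G) :
    PolyTime ea id fun a => (F a).map Sum.inl ++ (G a).map Sum.inr := by
  have : Inhabited (β ⊕ γ) := ⟨.inl default⟩
  suffices h : PolyTime ea id fun a => ((F a).map Sum.inl ++ (G a).map Sum.inr).reverse by
    simpa using polyTime_reverse.comp h
  obtain ⟨q₁, hq₁⟩ := hF.exists_length_le
  obtain ⟨q₂, hq₂⟩ := hG.exists_length_le
  obtain ⟨M₁, i₁, o₁, p₁, h₁⟩ := hF.exists_run
  obtain ⟨M₂, i₂, o₂, p₂, h₂⟩ := hG.exists_run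
  have := M₁.kFin
  have := M₂.kFin
  have := M₁.ΛFin
  have := M₂.ΛFin
  have := M₁.σFin
  have := M₂.σFin
  let Γ : M₁.K ⊕ (M₂.K ⊕ Bool) → Type :=
    Sum.elim M₁.Γ (Sum.elim M₂.Γ fun b => bif b then β ⊕ γ else αΓ)
  have : Inhabited (Γ (.inr (.inr false))) := ⟨(default : αΓ)⟩
  have : Inhabited (Γ (.inr (.inr true))) := ⟨(.inl default : β ⊕ γ)⟩
  have : Fintype (Γ (.inr (.inr false))) := @Fintype.ofEquiv αΓ _ M₁.Γk₀Fin i₁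
  have : Fintype (Γ (.inr (.inr true))) := @Fintype.ofEquiv (β ⊕ γ) _ _ (Equiv.refl (β ⊕ γ))
  have : Fintype (Γ (.inl M₁.k₀)) := M₁.Γk₀Fin
  refine polyTime_of_run (Γ := Γ) (.inl M₁.k₀) (.inr (.inr true))
    (pairProgram (Γ := Γ) M₁.m M₂.m M₁.main M₂.main M₁.k₀ M₁.k₁ M₂.k₀ M₂.k₁ i₁ i₁.symm i₂.symm
      (fun x => (.inl (o₁ x) : β ⊕ γ)) (fun x => (.inr (o₂ x) : β ⊕ γ))) (.inr (.inr 0))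
    (M₁.initialState, M₂.initialState, none, none) i₁ (Equiv.refl (β ⊕ γ))
    (Polynomial.X + 1 + (Polynomial.X + 1 + (p₁ + (p₂ + (q₁ + 1 + (q₂ + 1)))))) fun a => ?_
  obtain ⟨n₁, hn₁, r₁⟩ := h₁ a
  obtain ⟨n₂, hn₂, r₂⟩ := h₂ a
  have e : (ea a).map i₂.symm = ((ea a).map i₁.symm).map fun x => i₂.symm (i₁ x) := by
    simp [Function.comp_def]
  rw [e] at r₂
  obtain ⟨v, S, r, hS⟩ := pairProgram_steps (Γ := Γ) (f := i₁) (g₁ := i₁.symm) (g₂ := i₂.symm)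
    (p₁ := fun x => (.inl (o₁ x) : β ⊕ γ)) (p₂ := fun x => (.inr (o₂ x) : β ⊕ γ))
    (List.length_map _) (List.length_map _) (List.length_map _) (fun x => i₁.symm_apply_apply x)
    r₁ r₂
  refine ⟨_, v, S, ?_, r, hS.trans ?_⟩
  · have := hq₁ a
    have := hq₂ a
    simp only [Polynomial.eval_add, Polynomial.eval_X, Polynomial.eval_one]
    omega
  · have e₁ : ((F a).map o₁.symm).map (fun x => (.inl (o₁ x) : β ⊕ γ)) = (F a).map Sum.inl := by
      simp [Function.comp_def]
    have e₂ : ((G a).map o₂.symm).map (fun x => (.inr (o₂ x) : β ⊕ γ)) = (G a).map Sum.inr := by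
      simp [Function.comp_def]
    exact (congrArg₂ (fun x y : List (β ⊕ γ) => (x ++ y).reverse) e₁ e₂).trans
      (List.map_id _).symm

end Algebra

/-! ### Closure properties of the polynomial-time functions -/

instance {β γ : Type} [Inhabited β] : Inhabited (β ⊕ γ) := ⟨.inl default⟩

section Algebra

variable {α αΓ : Type} {ea : α → List αΓ}

theorem PolyTime.congr {α' β β' βΓ : Type} {ea' : α' → List αΓ} {eb : β → List βΓ}
    {eb' : β' → List βΓ} {f : α → β} {f' : α' → β'} (h : PolyTime ea eb f) (i : α' → α)
    (hi : ∀ a, ea (i a) = ea' a) (hf : ∀ a, eb (f (i a)) = eb' (f' a)) : PolyTime ea' eb' f' := by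
  obtain ⟨aux, t, o⟩ := h
  exact ⟨⟨aux, t, fun a => by rw [← hf, ← hi]; exact o (i a)⟩⟩

theorem polyTime_encode [Fintype αΓ] (ea : α → List αΓ) : PolyTime ea id ea :=
  PolyTime.congr ⟨idComputableInPolyTime ea⟩ id (fun _ => rfl) fun _ => rfl

theorem polyTime_encodeBool_iff {b : α → Bool} :
    PolyTime ea Computability.encodeBool b ↔ PolyTime ea id fun a => [b a] :=
  ⟨fun h => h.congr id (fun _ => rfl) fun _ => rfl, fun h => h.congr id (fun _ => rfl) fun _ => rfl⟩

variable {β γ : Type} [Fintype β] [Fintype γ] [Inhabited β] [Inhabited γ] {F G : α → List β}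

theorem PolyTime.transduce {τ : Type} [Fintype τ] (hF : PolyTime ea id F) (δ : τ → β → τ)
    (out : τ → β → Option γ) (fin : τ → Option γ) (s : τ) :
    PolyTime ea id fun a => QueryOrder.transduce δ out fin s (F a) :=
  (polyTime_transduce δ out fin s).comp hF

theorem PolyTime.filterMap (hF : PolyTime ea id F) (p : β → Option γ) :
    PolyTime ea id fun a => (F a).filterMap p := by
  refine (hF.transduce (fun (_ : Unit) _ => ()) (fun _ => p) (fun _ => none) ()).congr id
    (fun _ => rfl) fun a => ?_
  simp only [id]
  induction F a with
  | nil => rfl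
  | cons x w ih =>
    rw [QueryOrder.transduce, ih, List.filterMap_cons]
    cases p x <;> rfl

theorem PolyTime.map (hF : PolyTime ea id F) (p : β → γ) :
    PolyTime ea id fun a => (F a).map p := by
  simpa [List.filterMap_eq_map] using hF.filterMap (some ∘ p)

theorem PolyTime.reverse (hF : PolyTime ea id F) : PolyTime ea id fun a => (F a).reverse :=
  polyTime_reverse.comp hF

theorem PolyTime.append [Inhabited αΓ] (hF : PolyTime ea id F) (hG : PolyTime ea id G) :
    PolyTime ea id fun a => F a ++ G a := by
  refine ((hF.pair hG).filterMap (Sum.elim some some)).congr id (fun _ => rfl) fun a => ?_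
  simp [List.filterMap_append, List.filterMap_map, Function.comp_def]

/-- Predicates of the word computed by `F` that a finite automaton decides. -/
theorem PolyTime.automaton {τ : Type} [Fintype τ] (hF : PolyTime ea id F) (δ : τ → β → τ) (s : τ)
    (p : τ → γ) : PolyTime ea id fun a => [p ((F a).foldl δ s)] := by
  refine (hF.transduce δ (fun _ _ => none) (fun s => some (p s)) s).congr id
    (fun _ => rfl) fun a => ?_
  simp only [id]
  induction F a generalizing s with
  | nil => rfl
  | cons x w ih => exact ih _

theorem PolyTime.head (hF : PolyTime ea id F) (p : Option β → Bool) :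
    PolyTime ea Computability.encodeBool fun a => p (F a).head? := by
  rw [polyTime_encodeBool_iff]
  refine (hF.automaton (fun s x => s <|> some x) none p).congr id (fun _ => rfl) fun a => ?_
  have : ∀ (x : β) (w : List β), w.foldl (fun s y => s <|> some y) (some x) = some x := by
    intro x w
    induction w with
    | nil => rfl
    | cons y w ih => exact ih
  cases h : F a with
  | nil => simp [h]
  | cons x w =>
    simp only [id, h]
    exact congrArg (fun o => [p o]) (this x w)

theorem PolyTime.tail (hF : PolyTime ea id F) : PolyTime ea id fun a => (F a).tail := by
  refine (hF.transduce (fun (_ : Bool) _ => true) (fun s x => if s then some x else none)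
    (fun _ => none) false).congr id (fun _ => rfl) fun a => ?_
  have : ∀ w : List β, QueryOrder.transduce (fun (_ : Bool) _ => true)
      (fun s x => if s then some x else none) (fun _ => none) true w = w := by
    intro w
    induction w with
    | nil => rfl
    | cons y w ih => simp [QueryOrder.transduce, ih]
  cases h : F a with
  | nil => simp [h, QueryOrder.transduce]
  | cons x w => simp [h, QueryOrder.transduce, this]

/-- All three values are written in one word, the bit first; a transducer remembers the bit and lets
only the chosen part through. -/
theorem PolyTime.ite [Inhabited αΓ] {b : α → Bool} (hb : PolyTime ea Computability.encodeBool b)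
    (hF : PolyTime ea id F) (hG : PolyTime ea id G) :
    PolyTime ea id fun a => if b a then F a else G a := by
  refine (((polyTime_encodeBool_iff.1 hb).pair (hF.pair hG)).transduce
    (fun s x => Sum.elim id (fun _ => s) x)
    (fun s x => Sum.elim (fun _ => none)
      (Sum.elim (fun y => bif s then some y else none) fun y => bif s then none else some y) x)
    (fun _ => none) false).congr id (fun _ => rfl) fun a => ?_
  have h₁ : ∀ (s : Bool) (u v : List β), QueryOrder.transduce
      (fun (s : Bool) (x : Bool ⊕ (β ⊕ β)) => Sum.elim id (fun _ => s) x)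
      (fun s x => Sum.elim (fun _ => none)
        (Sum.elim (fun y => bif s then some y else none) fun y => bif s then none else some y) x)
      (fun _ => none) s ((u.map Sum.inl ++ v.map Sum.inr).map Sum.inr) = bif s then u else v := by
    intro s u v
    induction u with
    | nil =>
      induction v with
      | nil => cases s <;> rfl
      | cons y v ih =>
        simp only [List.map_nil, List.nil_append] at ih
        cases s <;> simp [QueryOrder.transduce, ih, -List.map_map]
    | cons y u ih =>
      simp only [List.map_append] at ih
      cases s <;> simp [QueryOrder.transduce, ih, -List.map_map]
  simp only [id, List.map_cons, List.map_nil, List.singleton_append, QueryOrder.transduce,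
    Sum.elim_inl, h₁]
  cases b a <;> rfl

end Algebra

/-! ### Constants, boolean operations and pairs of words. -/

section Words

variable {α αΓ : Type} [Fintype αΓ] [Inhabited αΓ] {ea : α → List αΓ}

theorem polyTime_const {β : Type} [Fintype β] [Inhabited β] (w : List β) :
    PolyTime ea id fun _ => w := by
  induction w with
  | nil => simpa using (polyTime_encode ea).filterMap fun _ => (none : Option β)
  | cons x w ih =>
    exact ((polyTime_encode ea).automaton (fun (_ : Unit) _ => ()) () fun _ => x).append ih

omit [Fintype αΓ] in
theorem PolyTime.bool₂ {b c : α → Bool} (hb : PolyTime ea Computability.encodeBool b)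
    (hc : PolyTime ea Computability.encodeBool c) (op : Bool → Bool → Bool) :
    PolyTime ea Computability.encodeBool fun a => op (b a) (c a) := by
  rw [polyTime_encodeBool_iff] at *
  have h : ∀ x, PolyTime ea id fun a => [op x (c a)] := fun x => hc.map (op x)
  refine ((polyTime_encodeBool_iff.2 hb).ite (h true) (h false)).congr id (fun _ => rfl)
    fun a => ?_
  simp only [id]
  cases b a <;> rfl

theorem polyTime_bool_const (x : Bool) : PolyTime ea Computability.encodeBool fun _ => x :=
  polyTime_encodeBool_iff.2 (polyTime_const [x])

theorem polyTime_decide_of_finite {ι : Type} [Finite ι] {p : ι → α → Prop}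
    [∀ i a, Decidable (p i a)] [∀ a, Decidable (∃ i, p i a)]
    (h : ∀ i, PolyTime ea Computability.encodeBool fun a => decide (p i a)) :
    PolyTime ea Computability.encodeBool fun a => decide (∃ i, p i a) := by
  classical
  have key : ∀ s : Finset ι, PolyTime ea Computability.encodeBool fun a =>
      decide (∃ i ∈ s, p i a) := by
    intro s
    induction s using Finset.induction_on with
    | empty => simpa using polyTime_bool_const (ea := ea) false
    | insert i s _ ih =>
      refine ((h i).bool₂ ih or).congr id (fun _ => rfl) fun a => ?_
      simp
  cases nonempty_fintype ι
  simpa using key Finset.univ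

theorem polyTime_fst : PolyTime encodePair id Prod.fst := by
  refine ((polyTime_encode encodePair).filterMap Sum.getLeft?).congr id (fun _ => rfl) fun a => ?_
  simp [encodePair, Computability.encodingProd, Computability.encodingList, List.filterMap_append,
    List.filterMap_map, Function.comp_def]

theorem polyTime_snd : PolyTime encodePair id Prod.snd := by
  refine ((polyTime_encode encodePair).filterMap Sum.getRight?).congr id (fun _ => rfl) fun a => ?_
  simp [encodePair, Computability.encodingProd, Computability.encodingList, List.filterMap_append,
    List.filterMap_map, Function.comp_def]

omit [Fintype αΓ] in
theorem PolyTime.prodMk {F G : α → Word} (hF : PolyTime ea id F) (hG : PolyTime ea id G) :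
    PolyTime ea encodePair fun a => (F a, G a) :=
  (hF.pair hG).congr id (fun _ => rfl) fun _ => rfl

end Words

/-! ### Closure properties of NP -/

section NP

/-- The subword of the letters marked with `t`: the word is read in blocks of two letters, each
consisting of a mark and a letter. -/
def unmark (t : Bool) : Word → Word
  | m :: b :: w => if m = t then b :: unmark t w else unmark t w
  | _ => []

theorem polyTime_unmark (t : Bool) : PolyTime id id (unmark t) := by
  refine (polyTime_transduce (fun (s : Option Bool) x => s.elim (some x) fun _ => none)
    (fun s x => s.elim none fun m => if m = t then some x else none) (fun _ => none) none).congr id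
    (fun _ => rfl) fun w => ?_
  simp only [id]
  induction w using unmark.induct t with
  | case1 b w ih => simp [unmark, transduce, ih]
  | case2 m b w h ih => simp [unmark, transduce, h, ih]
  | case3 w h =>
    match w, h with
    | [], _ => rfl
    | [x], _ => rfl
    | x :: y :: w, h => exact absurd rfl (h x y w)

/-- The `+ 1` accounts for an unpaired last letter, which `unmark` ignores. The bound keeps joint
witnesses polynomially short. -/
theorem length_le_unmark (w : Word) :
    w.length ≤ 2 * ((unmark true w).length + (unmark false w).length) + 1 := by
  induction w using unmark.induct true with
  | case1 b w ih => simp [unmark]; omega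
  | case2 m b w h ih => simp only [Bool.not_eq_true] at h; subst h; simp [unmark]; omega
  | case3 w h =>
    match w, h with
    | [], _ => simp
    | [x], _ => simp
    | x :: y :: w, h => exact absurd rfl (h x y w)

theorem exists_unmark (u v : Word) : ∃ w, unmark true w = u ∧ unmark false w = v := by
  induction u with
  | nil =>
    induction v with
    | nil => exact ⟨[], rfl, rfl⟩
    | cons b v ih =>
      obtain ⟨w, h₁, h₂⟩ := ih
      exact ⟨false :: b :: w, by simp [unmark, h₁], by simp [unmark, h₂]⟩
  | cons b u ih =>
    obtain ⟨w, h₁, h₂⟩ := ih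
    exact ⟨true :: b :: w, by simp [unmark, h₁], by simp [unmark, h₂]⟩

theorem setOf_mem_NP {b : Word → Bool} (hb : PolyTime id Computability.encodeBool b) :
    {x | b x = true} ∈ NP := by
  refine ⟨fun z => b z.1 && z.2.isEmpty, 0, ?_, ?_, ?_⟩
  · have h := (polyTime_snd.head Option.isNone)
    refine ((hb.comp polyTime_fst).bool₂ h and).congr id (fun _ => rfl) fun z => ?_
    rcases z with ⟨x, _ | ⟨y, w⟩⟩ <;> rfl
  · intro x y h
    simp at h
    simp [h.2]
  · intro x
    simp

theorem empty_mem_NP : (∅ : Lang) ∈ NP := by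
  simpa using setOf_mem_NP (polyTime_bool_const false)

theorem univ_mem_NP : (Set.univ : Lang) ∈ NP := by
  simpa using setOf_mem_NP (polyTime_bool_const true)

theorem inter_mem_NP {A B : Lang} (hA : A ∈ NP) (hB : B ∈ NP) : A ∩ B ∈ NP := by
  obtain ⟨R, p, hR, hp, hA⟩ := hA
  obtain ⟨S, q, hS, hq, hB⟩ := hB
  -- A single word carries both witnesses, told apart by the marks.
  refine ⟨fun z => R (z.1, unmark true z.2) && S (z.1, unmark false z.2),
    2 * (p + q) + 1, ?_, ?_, ?_⟩
  · have h₁ := polyTime_fst.prodMk ((polyTime_unmark true).comp polyTime_snd)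
    have h₂ := polyTime_fst.prodMk ((polyTime_unmark false).comp polyTime_snd)
    exact (hR.comp h₁).bool₂ (hS.comp h₂) and
  · intro x y h
    simp only [Bool.and_eq_true] at h
    have := hp _ _ h.1
    have := hq _ _ h.2
    have := length_le_unmark y
    simp
    omega
  · intro x
    simp only [Set.mem_inter_iff, hA, hB, Bool.and_eq_true]
    constructor
    · rintro ⟨⟨u, hu⟩, v, hv⟩
      obtain ⟨w, rfl, rfl⟩ := exists_unmark u v
      exact ⟨w, hu, hv⟩
    · rintro ⟨w, h₁, h₂⟩
      exact ⟨⟨_, h₁⟩, _, h₂⟩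

theorem union_mem_NP {A B : Lang} (hA : A ∈ NP) (hB : B ∈ NP) : A ∪ B ∈ NP := by
  obtain ⟨R, p, hR, hp, hA⟩ := hA
  obtain ⟨S, q, hS, hq, hB⟩ := hB
  -- The first letter of the witness says which of the two languages the rest is for.
  refine ⟨fun z => (z.2.head? == some true && R (z.1, z.2.tail)) ||
    (z.2.head? == some false && S (z.1, z.2.tail)), p + q + 1, ?_, ?_, ?_⟩
  · have h := polyTime_fst.prodMk polyTime_snd.tail
    exact ((polyTime_snd.head (· == some true)).bool₂ (hR.comp h) and).bool₂
      ((polyTime_snd.head (· == some false)).bool₂ (hS.comp h) and) or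
  · intro x y h
    simp only [Bool.or_eq_true, Bool.and_eq_true] at h
    have h' : y.tail.length ≤ p.eval x.length + q.eval x.length := by
      rcases h with h | h
      · exact (hp _ _ h.2).trans (by omega)
      · exact (hq _ _ h.2).trans (by omega)
    simp at h' ⊢
    omega
  · intro x
    simp only [Set.mem_union, hA, hB, Bool.or_eq_true, Bool.and_eq_true]
    constructor
    · rintro (⟨y, hy⟩ | ⟨y, hy⟩)
      · exact ⟨true :: y, .inl ⟨rfl, hy⟩⟩
      · exact ⟨false :: y, .inr ⟨rfl, hy⟩⟩
    · rintro ⟨y, h | h⟩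
      · exact .inl ⟨_, h.2⟩
      · exact .inr ⟨_, h.2⟩

theorem preimage_mem_NP {A : Lang} (hA : A ∈ NP) {f : Word → Word} (hf : PolyTime id id f) :
    {x | f x ∈ A} ∈ NP := by
  obtain ⟨R, p, hR, hp, hA⟩ := hA
  obtain ⟨q, hq⟩ := hf.exists_length_le
  refine ⟨fun z => R (f z.1, z.2), p.comp q, ?_, ?_, fun x => hA (f x)⟩
  · exact hR.comp ((hf.comp polyTime_fst).prodMk polyTime_snd)
  · intro x y h
    rw [Polynomial.eval_comp]
    exact (hp _ _ h).trans (eval_mono p (hq x))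

theorem setOf_exists_mem_NP {ι : Type} [Finite ι] {A : ι → Lang} (hA : ∀ i, A i ∈ NP) :
    {x | ∃ i, x ∈ A i} ∈ NP := by
  classical
  have key : ∀ s : Finset ι, {x | ∃ i ∈ s, x ∈ A i} ∈ NP := by
    intro s
    induction s using Finset.induction_on with
    | empty => simpa using empty_mem_NP
    | insert i s _ ih =>
      convert union_mem_NP (hA i) ih using 1
      ext x
      simp
  cases nonempty_fintype ι
  simpa using key Finset.univ

theorem setOf_forall_mem_NP {ι : Type} (s : Finset ι) {A : ι → Lang} (hA : ∀ i ∈ s, A i ∈ NP) :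
    {x | ∀ i ∈ s, x ∈ A i} ∈ NP := by
  classical
  induction s using Finset.induction_on with
  | empty => simpa using univ_mem_NP
  | insert i s _ ih =>
    convert inter_mem_NP (hA i (by simp)) (ih fun j hj => hA j (by simp [hj])) using 1
    ext x
    simp

end NP

/-! ### Mind changes -/

/-- The languages that are decided by a polynomial-time predicate, up to a number `N x ≤ m` of mind
changes that can be verified in NP. -/
def MindChange (m : ℕ) : Set Lang :=
  {L | ∃ (φ : Word → Bool) (N : Word → ℕ), PolyTime id Computability.encodeBool φ ∧
    (∀ x, N x ≤ m) ∧ (∀ i, {x | i < N x} ∈ NP) ∧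
    ∀ x, x ∈ L ↔ (φ x ^^ decide (Odd (N x))) = true}

section Alternates

variable {ι : Type}

/-- There is a chain of sets from `∅` to `S` along which the value of `g` changes `n` times. -/
def Alternates (g : Finset ι → Bool) : ℕ → Finset ι → Prop
  | 0, S => g S = g ∅
  | n + 1, S => ∃ S', S' ⊂ S ∧ Alternates g n S' ∧ g S' ≠ g S

/-- Every change flips a boolean, so only the parity of the number of changes matters. -/
theorem Alternates.value {g : Finset ι → Bool} {n : ℕ} {S : Finset ι} (h : Alternates g n S) :
    g S = (g ∅ ^^ decide (Odd n)) := by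
  induction n generalizing S with
  | zero =>
    have : g S = g ∅ := h
    simpa using this
  | succ n ih =>
    obtain ⟨S', -, h', hne⟩ := h
    have h₁ := ih h'
    rw [h₁] at hne
    by_cases hn : Odd n
    · have : ¬ Odd (n + 1) := by simpa [Nat.odd_add_one] using hn
      revert hne
      simp only [hn, this]
      cases g S <;> cases g ∅ <;> simp
    · have : Odd (n + 1) := by simpa [Nat.odd_add_one] using hn
      revert hne
      simp only [hn, this]
      cases g S <;> cases g ∅ <;> simp

/-- As `g` sees only `S ∩ Y`, each change of value needs a new element of `Y`. -/
theorem Alternates.le_card [DecidableEq ι] {g : Finset ι → Bool} {Y : Finset ι}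
    (hY : ∀ S, g S = g (S ∩ Y)) {n : ℕ} {S : Finset ι} (h : Alternates g n S) :
    n ≤ (S ∩ Y).card := by
  induction n generalizing S with
  | zero => simp
  | succ n ih =>
    obtain ⟨S', hS, h', hne⟩ := h
    refine Nat.succ_le_of_lt ((ih h').trans_lt (Finset.card_lt_card ?_))
    refine lt_of_le_of_ne (Finset.inter_subset_inter_right hS.subset) fun he => hne ?_
    rw [hY S', hY S, he]

open Classical in
theorem polyTime_alternates [Finite ι] {g : Word → Finset ι → Bool}
    (hg : ∀ S, PolyTime id Computability.encodeBool fun x => g x S) (n : ℕ) (S : Finset ι) :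
    PolyTime id Computability.encodeBool fun x => decide (Alternates (g x) n S) := by
  induction n generalizing S with
  | zero =>
    refine ((hg S).bool₂ (hg ∅) (· == ·)).congr id (fun _ => rfl) fun x => ?_
    congr 1
    rw [Bool.eq_iff_iff]
    simp only [beq_iff_eq, Alternates]
    exact (@decide_eq_true_iff _ (_)).symm
  | succ n ih =>
    refine polyTime_decide_of_finite fun S' => ?_
    refine ((polyTime_bool_const (decide (S' ⊂ S))).bool₂ ((ih S').bool₂
      ((hg S').bool₂ (hg S) (· != ·)) and) and).congr id (fun _ => rfl) fun x => ?_
    simp only [id, Bool.decide_and, ne_eq, decide_not]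
    cases g x S <;> cases g x S' <;> rfl

open Classical in
/-- If membership in `L` is a polynomial-time function of the set of those NP events that occur,
and the value of this function changes at most `m` times along a chain of sets, then `L` is in
`MindChange m`. -/
theorem mem_mindChange_of_events [Fintype ι] {L : Lang} {E : ι → Lang} (hE : ∀ i, E i ∈ NP)
    {g : Word → Finset ι → Bool} (hg : ∀ S, PolyTime id Computability.encodeBool fun x => g x S)
    (hL : ∀ x, x ∈ L ↔ g x (Finset.univ.filter fun i => x ∈ E i) = true) {m : ℕ}
    (hm : ∀ x S, ¬ Alternates (g x) (m + 1) S) : L ∈ MindChange m := by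
  set T : Word → Finset ι := fun x => Finset.univ.filter fun i => x ∈ E i with hT
  -- A chain inside `T x` relies on the occurrence of events and never on their failure, which makes
  -- `D x n` an NP condition.
  let D : Word → ℕ → Prop := fun x n => ∃ S, S ⊆ T x ∧ Alternates (g x) n S
  have hDzero : ∀ x, D x 0 := fun x => ⟨∅, Finset.empty_subset _, rfl⟩
  have hDsucc : ∀ x n, D x (n + 1) → D x n := fun x n ⟨S, hS, S', hS', h, _⟩ =>
    ⟨S', hS'.subset.trans hS, h⟩
  have hDanti : ∀ x i n, i ≤ n → D x n → D x i := fun x i n hin h =>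
    Nat.decreasingInduction (motive := fun k _ => D x k) (fun k _ => hDsucc x k) h hin
  have hDm : ∀ x n, D x n → n ≤ m := fun x n h => by
    by_contra hn
    obtain ⟨S, -, hS⟩ := hDanti x (m + 1) n (by omega) h
    exact hm x S hS
  let N : Word → ℕ := fun x => Nat.findGreatest (D x) m
  have hN : ∀ x, D x (N x) := fun x => Nat.findGreatest_spec (Nat.zero_le m) (hDzero x)
  have hlt : ∀ x i, i < N x ↔ D x (i + 1) := fun x i =>
    ⟨fun h => hDanti x (i + 1) (N x) h (hN x), fun h => Nat.le_findGreatest (hDm x _ h) h⟩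
  refine ⟨fun x => g x ∅, N, hg ∅, fun x => Nat.findGreatest_le m, fun i => ?_, fun x => ?_⟩
  · have : {x | i < N x} = {x | ∃ S : Finset ι, x ∈ {x | ∀ i ∈ S, x ∈ E i} ∩
        {x | decide (Alternates (g x) (i + 1) S) = true}} := by
      ext x
      simp [hlt, D, T, Finset.subset_iff]
    rw [this]
    exact setOf_exists_mem_NP fun S => inter_mem_NP (setOf_forall_mem_NP S fun i _ => hE i)
      (setOf_mem_NP (polyTime_alternates hg _ S))
  · obtain ⟨S, hS, h⟩ := hN x
    -- Otherwise `T x` could be put on top of the longest chain, giving one more change.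
    have : g x S = g x (T x) := by
      by_contra hne
      have : D x (N x + 1) :=
        ⟨T x, subset_rfl, S, lt_of_le_of_ne hS fun he => hne (by rw [he]), h, hne⟩
      have := (hlt x (N x)).2 this
      omega
    rw [hL, ← h.value, this]

end Alternates

/-! ### The boolean hierarchy and mind changes -/

/-- The value of a level-`n` boolean combination `e 0 ∧ ¬ (e 1 ∧ ¬ (e 2 ∧ …))`. -/
def bhVal : ∀ n : ℕ, (Fin n → Bool) → Bool
  | 0, _ => false
  | n + 1, e => e 0 && !bhVal n (Fin.tail e)

theorem bhVal_false (n : ℕ) : bhVal n (fun _ => false) = false := by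
  cases n <;> simp [bhVal]

theorem bhVal_true (n : ℕ) : bhVal n (fun _ => true) = decide (Odd n) := by
  induction n with
  | zero => rfl
  | succ n ih =>
    have : Fin.tail (fun _ : Fin (n + 1) => true) = fun _ => true := rfl
    rw [bhVal, this, ih]
    by_cases h : Odd n <;> simp [h, Nat.odd_add_one]

open Classical in
theorem exists_events_of_mem_BH {n : ℕ} {L : Lang} (hL : L ∈ BH n) :
    ∃ E : Fin n → Lang, (∀ i, E i ∈ NP) ∧
      ∀ x, decide (x ∈ L) = bhVal n fun i => decide (x ∈ E i) := by
  induction n generalizing L with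
  | zero => exact absurd hL (Set.notMem_empty L)
  | succ n ih =>
    cases n with
    | zero => exact ⟨fun _ => L, fun _ => hL, fun x => by simp [bhVal]⟩
    | succ n =>
      obtain ⟨A, hA, B, hB, rfl⟩ := hL
      obtain ⟨E, hE, h⟩ := ih hB
      refine ⟨Fin.cons A E, Fin.cases hA hE, fun x => ?_⟩
      have : Fin.tail (fun i : Fin (n + 2) => decide (x ∈ (Fin.cons A E : Fin (n + 2) → Lang) i)) =
          fun i => decide (x ∈ E i) := by
        funext i
        simp [Fin.tail]
      rw [bhVal, this, ← h]
      simp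

/-- A positive `N x` has odd truncation at `n + 2` iff `N x - 1` does not have odd truncation at `n
+ 1`. So the set is `{x | 0 < N x}` minus the set for `N - 1`, just as in the definition of `BH`. -/
theorem setOf_odd_min_mem_BH (n : ℕ) (N : Word → ℕ) (hN : ∀ i, {x | i < N x} ∈ NP) :
    {x | Odd (min (N x) (n + 1))} ∈ BH (n + 1) := by
  induction n generalizing N with
  | zero =>
    have : {x | Odd (min (N x) (0 + 1))} = {x | 0 < N x} := by
      ext x
      simp only [Nat.odd_iff, Set.mem_ofPred_eq]
      omega
    rw [this]
    exact hN 0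
  | succ n ih =>
    refine ⟨_, hN 0, _, ih (fun x => N x - 1) fun i => ?_, ?_⟩
    · convert hN (i + 1) using 1
      ext x
      simp only [Set.mem_ofPred_eq]
      omega
    · ext x
      simp only [Set.mem_ofPred_eq, Set.mem_sdiff]
      rcases h : N x with _ | t
      · simp
      · rw [Nat.add_sub_cancel, Nat.succ_min_succ, Nat.odd_add_one]
        simp

/-! ### The tree of two queries and its mind changes. -/

section Tree

variable {j k l : ℕ}

open Classical in
-- The events are the NP languages that make up `A`, `B` and `C`, taken at the respective query
-- words. Each change consumes an event, which settles the bound `j + k + l`; the exceptional case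
-- rests on comparing the outcomes for no events and for all events.
theorem mem_mindChange_of_queries {A B C L : Lang} (hk : 1 ≤ k) (hA : A ∈ BH j) (hB : B ∈ BH k)
    (hC : C ∈ BH l) {q₁ : Word → Word} {q₂ : Bool → Word → Word} {out : Bool → Bool → Word → Bool}
    (hq₁ : PolyTime id id q₁) (hq₂ : ∀ a, PolyTime id id (q₂ a))
    (hout : ∀ a b, PolyTime id Computability.encodeBool (out a b))
    (hL : ∀ x, x ∈ L ↔ out (chi A (q₁ x)) (chi (if chi A (q₁ x) then C else B)
      (q₂ (chi A (q₁ x)) x)) x = true) :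
    L ∈ MindChange (if Even j ∧ Odd l then j + k + l - 1 else j + k + l) := by
  obtain ⟨EA, hEA, hA⟩ := exists_events_of_mem_BH hA
  obtain ⟨EB, hEB, hB⟩ := exists_events_of_mem_BH hB
  obtain ⟨EC, hEC, hC⟩ := exists_events_of_mem_BH hC
  let E : Fin j ⊕ (Fin k ⊕ Fin l) → Lang := Sum.elim (fun i => {x | q₁ x ∈ EA i})
    (Sum.elim (fun i => {x | q₂ false x ∈ EB i}) fun i => {x | q₂ true x ∈ EC i})
  let a : Finset (Fin j ⊕ (Fin k ⊕ Fin l)) → Bool := fun S => bhVal j fun i => decide (.inl i ∈ S)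
  let b : Finset (Fin j ⊕ (Fin k ⊕ Fin l)) → Bool := fun S =>
    bhVal k fun i => decide (.inr (.inl i) ∈ S)
  let c : Finset (Fin j ⊕ (Fin k ⊕ Fin l)) → Bool := fun S =>
    bhVal l fun i => decide (.inr (.inr i) ∈ S)
  let g : Word → Finset (Fin j ⊕ (Fin k ⊕ Fin l)) → Bool := fun x S =>
    out (a S) (bif a S then c S else b S) x
  have hcard : ∀ S : Finset (Fin j ⊕ (Fin k ⊕ Fin l)), S.card ≤ j + k + l := fun S => by
    have := Finset.card_le_univ S
    simp only [Fintype.card_sum, Fintype.card_fin] at this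
    omega
  have hle : ∀ x n S, Alternates (g x) n S → n ≤ S.card := fun x n S h => by
    simpa using h.le_card (Y := Finset.univ) fun S => by simp
  refine mem_mindChange_of_events (E := E) (g := g) ?_ (fun S => hout _ _) (fun x => ?_)
    fun x S hS => ?_
  · rintro (i | i | i)
    · exact preimage_mem_NP (hEA i) hq₁
    · exact preimage_mem_NP (hEB i) (hq₂ false)
    · exact preimage_mem_NP (hEC i) (hq₂ true)
  · have ha : a (Finset.univ.filter fun i => x ∈ E i) = chi A (q₁ x) := by
      simp [a, E, chi, hA]
    have hb : b (Finset.univ.filter fun i => x ∈ E i) = chi B (q₂ false x) := by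
      simp [b, E, chi, hB]
    have hc : c (Finset.univ.filter fun i => x ∈ E i) = chi C (q₂ true x) := by
      simp [c, E, chi, hC]
    rw [hL]
    simp only [g, ha, hb, hc]
    cases chi A (q₁ x) <;> rfl
  split_ifs at hS with hjl
  swap
  · have := hle _ _ _ hS
    have := hcard S
    omega
  have hn : j + k + l - 1 + 1 = j + k + l := by omega
  rw [hn] at hS
  -- If the answer of `B` is irrelevant, the events of `B` cause no change, and there is at least
  -- one of them since `1 ≤ k`.
  by_cases hconst : out false true x = out false false x
  · have hY := hS.le_card (Y := Finset.univ.filter fun i => ∀ i', i ≠ .inr (.inl i')) fun S => by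
      have ha : a (S ∩ Finset.univ.filter fun i => ∀ i', i ≠ .inr (.inl i')) = a S := by
        simp [a]
      have hc : c (S ∩ Finset.univ.filter fun i => ∀ i', i ≠ .inr (.inl i')) = c S := by
        simp [c]
      simp only [g, ha, hc]
      cases a S
      · simp only [cond_false]
        cases b S <;> cases b (S ∩ Finset.univ.filter fun i => ∀ i', i ≠ .inr (.inl i')) <;>
          simp [hconst]
      · rfl
    have hsub : (S ∩ Finset.univ.filter fun i => ∀ i', i ≠ .inr (.inl i')) ⊆
        (Finset.univ.erase (.inr (.inl ⟨0, hk⟩))) := by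
      intro i hi
      simp only [Finset.mem_inter, Finset.mem_filter, Finset.mem_univ, true_and] at hi
      simp [hi.2]
    have h₁ := Finset.card_le_card hsub
    rw [Finset.card_erase_of_mem (Finset.mem_univ _)] at h₁
    simp only [Finset.card_univ, Fintype.card_sum, Fintype.card_fin] at h₁
    omega
  -- So many changes use up every event; with `j` even, the first answer is then "no", as it is for
  -- the empty set.
  · have hSu : S = Finset.univ := by
      rw [← Finset.card_eq_iff_eq_univ]
      have := hle _ _ _ hS
      have := hcard S
      simp only [Fintype.card_sum, Fintype.card_fin]
      omega
    have hv := hS.value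
    rw [hSu] at hv
    have h₁ : g x Finset.univ = out false (decide (Odd k)) x := by
      have hj : decide (Odd j) = false := by simpa using hjl.1
      simp [g, a, b, bhVal_true, hj]
    have h₂ : g x ∅ = out false false x := by
      simp [g, a, b, bhVal_false]
    rw [h₁, h₂] at hv
    -- For odd `k` the number of changes is even, so the two outcomes agree, against `hconst`. For
    -- even `k` it is odd, although both outcomes are `out false false x`.
    by_cases hkodd : Odd k
    · have : ¬ Odd (j + k + l) := by
        have := hjl.1.add_odd hkodd
        simpa using this.add_odd hjl.2
      simp only [hkodd, this, decide_true, decide_false, Bool.xor_false] at hv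
      exact hconst hv
    · have : Odd (j + k + l) :=
        (hjl.1.add (Nat.not_odd_iff_even.1 hkodd)).add_odd hjl.2
      simp [hkodd, this] at hv

/-- The oracles are parities of truncated counts: `A` of `NA`, `B` of `N`, `C` of `NC`. By `h₁` the
answer of `C` misses the parity of `N x` by that of `k + 1`; the constant `s` makes up for this. -/
theorem exists_queries_of_counts {L : Lang} {φ : Word → Bool} {N NA NC : Word → ℕ} (hj : 1 ≤ j)
    (hk : 1 ≤ k) (hl : 1 ≤ l) (hφ : PolyTime id Computability.encodeBool φ)
    (hN : ∀ i, {x | i < N x} ∈ NP) (hNA : ∀ i, {x | i < NA x} ∈ NP)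
    (hNC : ∀ i, {x | i < NC x} ∈ NP)
    (hL : ∀ x, x ∈ L ↔ (φ x ^^ decide (Odd (N x))) = true)
    (h₁ : ∀ x, Odd (min (NA x) j) → (Odd (N x) ↔ Odd (min (NC x) l + (k + 1))))
    (h₂ : ∀ x, ¬ Odd (min (NA x) j) → (Odd (N x) ↔ Odd (min (N x) k))) :
    ∃ (φ : Word → Bool) (s : Bool), PolyTime id Computability.encodeBool φ ∧
      ∃ A ∈ BH j, ∃ B ∈ BH k, ∃ C ∈ BH l, ∀ x, x ∈ L ↔
        (φ x ^^ bif chi A x then chi C x ^^ s else chi B x) = true := by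
  have hBH : ∀ n, 1 ≤ n → ∀ N : Word → ℕ, (∀ i, {x | i < N x} ∈ NP) →
      {x | Odd (min (N x) n)} ∈ BH n := by
    intro n hn N hN
    obtain ⟨n, rfl⟩ := Nat.exists_eq_add_of_le' hn
    exact setOf_odd_min_mem_BH n N hN
  have hchi : ∀ (N : Word → ℕ) x, chi {x | Odd (N x)} x = decide (Odd (N x)) := fun N x => by
    rw [chi, decide_eq_decide]
    exact Iff.rfl
  refine ⟨φ, decide (Odd (k + 1)), hφ, _, hBH j hj NA hNA, _, hBH k hk N hN, _, hBH l hl NC hNC,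
    fun x => ?_⟩
  rw [hL]
  by_cases h : Odd (min (NA x) j)
  · have hx : decide (Odd (N x)) = (decide (Odd (min (NC x) l)) ^^ decide (Odd (k + 1))) := by
      rw [Bool.eq_iff_iff, decide_eq_true_iff, h₁ x h, Nat.odd_add, ← Nat.not_odd_iff_even]
      by_cases h₃ : Odd (min (NC x) l) <;> by_cases h₄ : Odd (k + 1) <;> simp [h₃, h₄]
    rw [hchi fun x => min (NA x) j, hchi fun x => min (NC x) l, decide_eq_true h, hx, cond_true]
  · rw [hchi fun x => min (NA x) j, hchi fun x => min (N x) k, decide_eq_false h, cond_false,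
      decide_eq_decide.2 (h₂ x h)]

/-- Up to `N x = k`, `A` says "no" and `B` follows the parity. Then `B` is stuck at the parity of
`k`, and `A` alternates between "yes", where the idle `C` yields the parity of `k + 1`, and "no".
Finally `A` must rest at "yes" while `C` counts up to `l` further changes. Resting at "yes" takes an
odd number of changes of `A`: all `j` if `j` is odd, only `j - 1` if `j` is even. -/
theorem exists_queries_of_mem_mindChange {L : Lang} (hj : 1 ≤ j) (hk : 1 ≤ k) (hl : 1 ≤ l)
    (hL : L ∈ MindChange (if Even j ∧ Odd l then j + k + l - 1 else j + k + l)) :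
    ∃ (φ : Word → Bool) (s : Bool), PolyTime id Computability.encodeBool φ ∧
      ∃ A ∈ BH j, ∃ B ∈ BH k, ∃ C ∈ BH l, ∀ x, x ∈ L ↔
        (φ x ^^ bif chi A x then chi C x ^^ s else chi B x) = true := by
  obtain ⟨φ, N, hφ, hm, hN, hL⟩ := hL
  have hshift : ∀ d i, {x | i < N x - d} ∈ NP := fun d i => by
    convert hN (i + d) using 2
    ext x
    omega
  rcases Nat.even_or_odd j with hje | hjo
  · rcases Nat.even_or_odd l with hle | hlo
    · have hnot : ¬ (Even j ∧ Odd l) := fun h => Nat.not_odd_iff_even.2 hle h.2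
      rw [if_neg hnot] at hm
      -- The change that `A` has left is spent at the very end, at `N x = j + k + l`: the answer of
      -- `B` takes over again, and its parity, that of `k`, is right because `j` and `l` are even.
      refine exists_queries_of_counts hj hk hl hφ hN (NA := fun x => min (N x - k) (j - 1) +
        if k + (j - 1) + l < N x then 1 else 0) (fun i => ?_) (hshift (k + (j - 1))) hL
        (fun x => ?_) fun x => ?_
      · rcases lt_trichotomy i (j - 1) with h | h | h
        · convert hshift k i using 2
          ext x
          split_ifs <;> omega
        · convert hN (k + (j - 1) + l) using 2
          ext x
          split_ifs <;> omega
        · convert empty_mem_NP using 1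
          ext x
          simp only [Set.mem_ofPred_eq, Set.mem_empty_iff_false, iff_false]
          split_ifs <;> omega
      all_goals
        have := hm x
        simp only [Nat.odd_iff, Nat.even_iff] at *
        split_ifs <;> omega
    · rw [if_pos ⟨hje, hlo⟩] at hm
      -- For odd `l` a return to `B` after `C` is exhausted would give the wrong parity, so `A`
      -- stops after `j - 1` changes.
      refine exists_queries_of_counts hj hk hl hφ hN (NA := fun x => min (N x - k) (j - 1))
        (fun i => ?_) (hshift (k + (j - 1))) hL (fun x => ?_) fun x => ?_
      · by_cases h : i < j - 1
        · convert hshift k i using 2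
          ext x
          omega
        · convert empty_mem_NP using 1
          ext x
          simp only [Set.mem_ofPred_eq, Set.mem_empty_iff_false, iff_false]
          omega
      all_goals
        have := hm x
        simp only [Nat.odd_iff, Nat.even_iff] at *
        omega
  · have hnot : ¬ (Even j ∧ Odd l) := fun h => Nat.not_odd_iff_even.2 h.1 hjo
    rw [if_neg hnot] at hm
    refine exists_queries_of_counts hj hk hl hφ hN (hshift k) (hshift (k + j)) hL
      (fun x => ?_) fun x => ?_
    all_goals
      have := hm x
      simp only [Nat.odd_iff, Nat.even_iff] at *
      omega

end Tree

/-! ### Simulating an oracle machine with prescribed answers -/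

namespace OracleTM

variable (M : OracleTM) (as : List Bool)

theorem step_of_ask_eq_none {O : List Bool → Lang} {l : M.Λ} (h : M.ask l = none) (v : M.σ)
    (T : ∀ k, List (M.Γ k)) (s : List Bool) :
    M.step O ⟨⟨some l, v, T⟩, s⟩ = some ⟨TM2.stepAux (M.m l) v T, s⟩ := by
  simp only [step, h]
  rfl

theorem step_of_ask_eq_some {O : List Bool → Lang} {l n y : M.Λ} (h : M.ask l = some (n, y))
    (v : M.σ) (T : ∀ k, List (M.Γ k)) (s : List Bool) :
    M.step O ⟨⟨some l, v, T⟩, s⟩ =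
      some ⟨⟨some (if chi (O s) ((T M.queryStack).map M.queryAlphabet) then y else n), v,
        Function.update T M.queryStack []⟩,
        s ++ [chi (O s) ((T M.queryStack).map M.queryAlphabet)]⟩ := by
  simp only [step, h]
  rfl

/-- Run `M` on the answers `as` without an oracle. When the answers are used up, or when `M` halts,
the verdict on the current state is written on an extra stack; the next query is then on the query
stack. -/
def answerProgram : Option (M.Λ × Fin (as.length + 1)) →
    TM2.Stmt (Sum.elim M.Γ fun _ : Unit => Bool) (Option (M.Λ × Fin (as.length + 1)))
      (M.σ × Bool)
  | none => .push (.inr ()) (fun v => M.accept v.1) .halt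
  | some (l, i) =>
    match M.ask l with
    | none => liftStmt Sum.inl Prod.fst (fun a v => (a, v.2)) (fun l => some (l, i)) (some none)
        (M.m l)
    | some (n, y) =>
      if h : (i : ℕ) < as.length then
        .pop (.inl M.queryStack) (fun v o => (v.1, o.isSome))
          (.branch Prod.snd (.goto fun _ => some (l, i))
            (.goto fun _ => some (if as[(i : ℕ)] then y else n, ⟨i + 1, by omega⟩)))
      else .goto fun _ => none

variable {M as}

theorem answers_prefix {O : List Bool → Lang} {n : ℕ} {c d : M.Cfg}
    (h : StepsTo (M.step O) n c d) : c.answers <+: d.answers := by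
  induction n generalizing c with
  | zero => cases h; exact List.prefix_rfl
  | succ n ih =>
    obtain ⟨e, he, h⟩ := h
    refine List.IsPrefix.trans ?_ (ih h)
    obtain ⟨⟨_ | l, v, T⟩, s⟩ := c
    · simp [step] at he
    cases hl : M.ask l with
    | none =>
      rw [step_of_ask_eq_none M hl, Option.some.injEq] at he
      subst he
      exact List.prefix_rfl
    | some ny =>
      rw [step_of_ask_eq_some M hl, Option.some.injEq] at he
      subst he
      exact List.prefix_append _ _

/-- Oracles that look only at the number of earlier answers can force any prescribed sequence of
answers. -/
theorem answers_eq {O : List Bool → Lang} {b : ℕ → Bool} (hO : ∀ s w, chi (O s) w = b s.length)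
    {n : ℕ} {c d : M.Cfg} (h : StepsTo (M.step O) n c d)
    (hc : ∀ i z, c.answers[i]? = some z → z = b i) : ∀ i z, d.answers[i]? = some z → z = b i := by
  induction n generalizing c with
  | zero => cases h; exact hc
  | succ n ih =>
    obtain ⟨e, he, h⟩ := h
    refine ih h ?_
    obtain ⟨⟨_ | l, v, T⟩, s⟩ := c
    · simp [step] at he
    cases hl : M.ask l with
    | none =>
      rw [step_of_ask_eq_none M hl, Option.some.injEq] at he
      subst he
      exact hc
    | some ny =>
      rw [step_of_ask_eq_some M hl, Option.some.injEq] at he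
      subst he
      intro i z hz
      simp only [hO, List.getElem?_append] at hz
      split_ifs at hz with hi
      · exact hc i z hz
      · obtain ⟨h₁, h₂⟩ := List.getElem?_eq_some_iff.1 hz
        simp only [List.length_singleton] at h₁
        obtain rfl : i = s.length := by omega
        simpa using h₂.symm

/-- The invariant is that the answers received so far form a prefix `s` of `as`, with `s.length` as
the counter in the label. `M` erases its query stack in one step, the simulation letter by letter.
Every erased letter was pushed earlier, at most `c` per step, or was there at the start, hence the
amortised bound. -/
theorem answerProgram_steps {c : ℕ}
    (hc : ∀ l v S k, ((TM2.stepAux (M.m l) v S).stk k).length ≤ (S k).length + c)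
    {O : List Bool → Lang} {d : M.Cfg} (hd : d.base.l = none)
    (has : ∀ i z, i < as.length → d.answers[i]? = some z → as[i]? = some z) (n : ℕ)
    (l : Option M.Λ) (v : M.σ × Bool) (T : ∀ k, List (M.Γ k)) (s : List Bool) (hs : s <+: as)
    (h : StepsTo (M.step O) n ⟨⟨l, v.1, T⟩, s⟩ d)
    (S : ∀ k, List (Sum.elim M.Γ (fun _ : Unit => Bool) k)) (hS : ∀ k, S (.inl k) = T k) :
    ∃ N w S', N ≤ (c + 1) * n + (T M.queryStack).length + 1 ∧
      StepsTo (TM2.step (M.answerProgram as)) N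
        ⟨some (l.map fun l => (l, ⟨s.length, Nat.lt_succ_of_le hs.length_le⟩)), v, S⟩
        ⟨none, w, S'⟩ ∧
      (∃ b : Bool, S' (.inr ()) = b :: S (.inr ()) ∧
        (d.answers.length ≤ as.length → b = M.accept d.base.var)) ∧
      ∀ z, d.answers[as.length]? = some z →
        z = chi (O as) ((S' (.inl M.queryStack)).map M.queryAlphabet) := by
  induction n generalizing l v T s S with
  | zero =>
    cases h
    obtain rfl : l = none := hd
    refine ⟨1, _, _, by omega, .single rfl, ⟨_, by simp [Function.update], fun _ => rfl⟩,
      fun z hz => ?_⟩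
    have := (List.getElem?_eq_some_iff.1 hz).1
    have := hs.length_le
    simp only at *
    omega
  | succ n ih =>
    obtain ⟨e, he, h⟩ := h
    obtain _ | l := l
    · simp [step] at he
    cases hl : M.ask l with
    | none =>
      rw [step_of_ask_eq_none M hl, Option.some.injEq] at he
      subst he
      obtain ⟨S₁, hS₁, hr, hf⟩ := stepAux_liftStmt (Γ' := Sum.elim M.Γ fun _ : Unit => Bool)
        (get := Prod.fst) (set := fun a (v : M.σ × Bool) => (a, v.2))
        Sum.inl_injective (fun _ _ => rfl) (fun _ _ _ => rfl) (fun _ => rfl)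
        (fun l => some (l, (⟨s.length, Nat.lt_succ_of_le hs.length_le⟩ : Fin (as.length + 1))))
        (some none) (M.m l) v T S hS
      obtain ⟨N, w, S', hN, hrun, ⟨b, hb, hb'⟩, hq⟩ := ih (TM2.stepAux (M.m l) v.1 T).l
        ((TM2.stepAux (M.m l) v.1 T).var, v.2) (TM2.stepAux (M.m l) v.1 T).stk s hs h S₁ hr
      refine ⟨N + 1, w, S', ?_, ⟨_, ?_, hrun⟩, ⟨b, ?_, hb'⟩, hq⟩
      · have := hc l v.1 T M.queryStack
        simp only [Nat.mul_add, Nat.add_mul] at hN ⊢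
        omega
      · simp only [Option.map_some, TM2.step, answerProgram, hl]
        refine congrArg some (hS₁.trans ?_)
        congr 1
        exact Option.rec rfl (fun _ => rfl) (TM2.stepAux (M.m l) v.1 T).l
      · rw [hb, hf _ (by simp)]
    | some ny =>
      obtain ⟨no, yes⟩ := ny
      rw [step_of_ask_eq_some M hl, Option.some.injEq] at he
      subst he
      have hpre := answers_prefix h
      have hlen := hs.length_le
      have hans : d.answers[s.length]? =
          some (chi (O s) ((T M.queryStack).map M.queryAlphabet)) := by
        obtain ⟨t, ht⟩ := hpre
        rw [← ht]
        simp
      by_cases hlt : s.length < as.length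
      · have has' := has _ _ hlt hans
        rw [List.getElem?_eq_getElem hlt, Option.some.injEq] at has'
        have hs' : s ++ [chi (O s) ((T M.queryStack).map M.queryAlphabet)] <+: as := by
          obtain ⟨t, rfl⟩ := hs
          obtain _ | ⟨z, t⟩ := t
          · simp at hlt
          · rw [← has']
            simp
        obtain ⟨S₁, r₁, hS₁, hS₁'⟩ := StepsTo.drain (step := TM2.step (M.answerProgram as))
          (L := some (l, ⟨s.length, Nat.lt_succ_of_le hs.length_le⟩))
          (next := some (some (if as[s.length] then yes else no, ⟨s.length + 1, by omega⟩)))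
          (src := Sum.inl M.queryStack)
          (fun _ _ => []) (fun o v => (v.1, o.isSome)) (fun _ _ _ => rfl)
          (fun v S h => by
            simp only [TM2.step, answerProgram, hl, hlt, dite_true, TM2.stepAux, h,
              List.head?_nil, List.tail_nil, Option.isSome_none, cond_false]
            rw [← h, Function.update_eq_self])
          (fun v S a w h => ⟨Function.update S (.inl M.queryStack) w, by
            simp only [TM2.step, answerProgram, hl, hlt, dite_true, TM2.stepAux, h,
              List.head?_cons, List.tail_cons, Option.isSome_some, cond_true],
            Function.update_self .., fun k hk => Function.update_of_ne hk ..⟩) v S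
        replace hS₁' : ∀ k, k ≠ .inl M.queryStack → S₁ k = S k := fun k hk =>
          (hS₁' k hk).trans (congrArg (· ++ S k) (List.flatMap_eq_nil_iff.2 fun _ _ => rfl))
        obtain ⟨N, w, S', hN, hrun, ⟨b, hb, hb'⟩, hq⟩ := ih _ (v.1, false)
          (Function.update T M.queryStack []) _ hs' h S₁ (fun k => by
            by_cases hk : k = M.queryStack
            · subst hk; simpa using hS₁
            · rw [hS₁' _ (by simpa using hk)]
              simp [hk, hS])
        refine ⟨(S (.inl M.queryStack)).length + 1 + N, w, S', ?_, r₁.trans ?_, ⟨b, ?_, hb'⟩, hq⟩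
        · have : (S (.inl M.queryStack)).length = (T M.queryStack).length :=
            congrArg List.length (hS _)
          simp only [Function.update_self, List.length_nil, Nat.mul_add, Nat.add_mul] at hN ⊢
          omega
        · rw [has']
          simpa using hrun
        · rw [hb, hS₁' _ (by simp)]
      -- The prescribed answers are used up: the simulation stops with the next query still on the
      -- query stack.
      · have hlen' : s.length = as.length := by omega
        obtain rfl : s = as := hs.eq_of_length hlen'
        refine ⟨2, _, _, ?_, ⟨_, by simp [answerProgram, hl]; rfl, .single rfl⟩,
          ⟨_, by simp [Function.update]; rfl, fun hd => ?_⟩, fun z hz => ?_⟩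
        · simp only [Nat.mul_add, Nat.add_mul]
          omega
        · have := (List.getElem?_eq_some_iff.1 hans).1
          omega
        · rw [hans, Option.some.injEq] at hz
          rw [← hz, ← hS, Function.update_of_ne (by simp)]

/-- `query` gives the word asked after the answers `as`, and `out` the verdict if nothing more is
asked. Both have to be total, also where the actual oracle answers differently; the time bound still
applies because it holds for all oracles. -/
theorem PolyTimeQueries.exists_answers {q : ℕ} (hM : M.PolyTimeQueries q) (as : List Bool) :
    ∃ (query : Word → Word) (out : Word → Bool), PolyTime id id query ∧
      PolyTime id Computability.encodeBool out ∧ ∀ O x d t, M.HaltsIn O x d t →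
        (∀ i z, i < as.length → d.answers[i]? = some z → as[i]? = some z) →
        (∀ z, d.answers[as.length]? = some z → z = chi (O as) (query x)) ∧
        (d.answers.length ≤ as.length → out x = M.accept d.base.var) := by
  have := M.kFin
  have := M.ΛFin
  have := M.σFin
  obtain ⟨p, hp⟩ := hM
  obtain ⟨c, hc⟩ := program_growth M.m
  let Γ : M.K ⊕ Unit → Type := Sum.elim M.Γ fun _ => Bool
  let start (x : Word) : TM2.Cfg Γ (Option (M.Λ × Fin (as.length + 1))) (M.σ × Bool) :=
    ⟨some (some (M.main, 0)), (M.initialState, false),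
      Function.update (fun _ => []) (.inl M.k₀) (x.map M.inputAlphabet.symm)⟩
  have key : ∀ O x d t, M.HaltsIn O x d t →
      (∀ i z, i < as.length → d.answers[i]? = some z → as[i]? = some z) →
      ∃ N w S', N ≤ (c + 1) * t + x.length + 1 ∧
        StepsTo (TM2.step (M.answerProgram as)) N (start x) ⟨none, w, S'⟩ ∧
        (∃ b : Bool, S' (.inr ()) = [b] ∧
          (d.answers.length ≤ as.length → b = M.accept d.base.var)) ∧
        ∀ z, d.answers[as.length]? = some z →
          z = chi (O as) ((S' (.inl M.queryStack)).map M.queryAlphabet) := by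
    intro O x d t ⟨hrun, hd⟩ has
    obtain ⟨n, hn, hrun⟩ := evalsToInTime_iff.1 hrun
    obtain ⟨N, w, S', hN, hrun, ⟨b, hb, hb'⟩, hq⟩ := answerProgram_steps hc hd has n (some M.main)
      (M.initialState, false) _ [] (List.nil_prefix) hrun
      (Function.update (fun _ => []) (.inl M.k₀) (x.map M.inputAlphabet.symm)) (fun k => by
        by_cases h : k = M.k₀
        · subst h
          exact (Function.update_self (β := fun k => List (Γ k)) (.inl M.k₀) _ _).trans
            (Function.update_self (β := fun k => List (M.Γ k)) M.k₀ _ _).symm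
        · rw [Function.update_of_ne h]
          exact Function.update_of_ne (f := fun k => ([] : List (Γ k))) (Sum.inl_injective.ne h) _)
    refine ⟨N, w, S', hN.trans ?_, hrun, ⟨b, hb, hb'⟩, hq⟩
    have h₁ := length_update_le M.k₀ (x.map M.inputAlphabet.symm) M.queryStack
    have h₂ := Nat.mul_le_mul_left (c + 1) hn
    rw [List.length_map] at h₁
    omega
  have runs : ∀ x, ∃ N w S', N ≤ (c + 1) * p.eval x.length + x.length + 1 ∧
      StepsTo (TM2.step (M.answerProgram as)) N (start x) ⟨none, w, S'⟩ ∧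
      ∃ b : Bool, S' (.inr ()) = [b] := by
    intro x
    -- This oracle, full or empty according to the position, gives exactly the answers `as`.
    obtain ⟨d, hd, -⟩ := hp (fun s => if as.getD s.length false then Set.univ else ∅) x
    obtain ⟨N, w, S', hN, hrun, ⟨b, hb, -⟩, -⟩ := key _ x d _ hd fun i z hi hz => by
      obtain ⟨n, -, hrun⟩ := evalsToInTime_iff.1 hd.1
      have := answers_eq (b := fun i => as.getD i false) (fun s w => by
        cases h : as.getD s.length false <;> simp [chi]) hrun (by simp [init]) i z hz
      rw [this, List.getD_eq_getElem _ _ hi, List.getElem?_eq_getElem hi]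
    exact ⟨N, w, S', hN, hrun, b, hb⟩
  choose N w S' hN hrun b hb using runs
  have : Fintype (Γ (.inl M.k₀)) := M.Γk₀Fin
  refine ⟨fun x => (S' x (.inl M.queryStack)).map M.queryAlphabet, b, ?_, ?_, ?_⟩
  · refine polyTime_of_run (Γ := Γ) (.inl M.k₀) (.inl M.queryStack) (M.answerProgram as)
      (some (M.main, 0)) (M.initialState, false) M.inputAlphabet M.queryAlphabet
      ((Polynomial.C c + 1) * p + Polynomial.X + 1) fun x =>
      ⟨N x, w x, S' x, by simpa using hN x, hrun x, ?_⟩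
    exact ((List.map_map ..).trans ((List.map_congr_left fun a _ =>
      M.queryAlphabet.symm_apply_apply a).trans (List.map_id _))).symm
  · exact polyTime_of_run (Γ := Γ) (.inl M.k₀) (.inr ()) (M.answerProgram as)
      (some (M.main, 0)) (M.initialState, false) M.inputAlphabet (Equiv.refl Bool)
      ((Polynomial.C c + 1) * p + Polynomial.X + 1) fun x =>
      ⟨N x, w x, S' x, by simpa using hN x, hrun x, hb x⟩
  · intro O x d t hd has
    obtain ⟨N', w', T, -, hrun', ⟨b', hb', hv⟩, hq⟩ := key O x d t hd has
    -- The simulation does not depend on the oracle, so by determinism this is the run for `O` too.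
    have heq := (hrun x).unique hrun' rfl rfl
    simp only [TM2.Cfg.mk.injEq, true_and] at heq
    obtain ⟨-, rfl⟩ := heq
    have : b x = b' := by simpa using (hb x).symm.trans hb'
    exact ⟨hq, fun h => this.trans (hv h)⟩

theorem HaltsIn.unique {O : List Bool → Lang} {x : Word} {c d : M.Cfg} {t u : ℕ}
    (hc : M.HaltsIn O x c t) (hd : M.HaltsIn O x d u) : c = d := by
  obtain ⟨m, -, h₁⟩ := evalsToInTime_iff.1 hc.1
  obtain ⟨n, -, h₂⟩ := evalsToInTime_iff.1 hd.1
  exact h₁.unique h₂ (by simp [step, hc.2]) (by simp [step, hd.2])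

theorem HaltsIn.accepts_iff {O : List Bool → Lang} {x : Word} {d : M.Cfg} {t : ℕ}
    (hd : M.HaltsIn O x d t) : M.Accepts O x ↔ M.accept d.base.var = true :=
  ⟨fun ⟨_, _, hc, h⟩ => hc.unique hd ▸ h, fun h => ⟨d, t, hd, h⟩⟩

/-- Answer lists of length 0, 1 and 2 yield the first query, the second query and the verdict. A run
with fewer queries does no harm: agreement is demanded only at positions where an answer was
received. -/
theorem PolyTimeQueries.exists_two_queries (hM : M.PolyTimeQueries 2) :
    ∃ (q₁ : Word → Word) (q₂ : Bool → Word → Word) (out : Bool → Bool → Word → Bool),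
      PolyTime id id q₁ ∧ (∀ a, PolyTime id id (q₂ a)) ∧
      (∀ a b, PolyTime id Computability.encodeBool (out a b)) ∧
      ∀ A B C x, M.Accepts (twoStage A B C) x ↔
        out (chi A (q₁ x)) (chi (if chi A (q₁ x) then C else B) (q₂ (chi A (q₁ x)) x)) x =
          true := by
  obtain ⟨q₁, _, hq₁, -, h₁⟩ := hM.exists_answers []
  choose q₂ _ hq₂ _ h₂ using fun a => hM.exists_answers [a]
  choose _ out _ hout h₃ using fun a b => hM.exists_answers [a, b]
  refine ⟨q₁, q₂, out, hq₁, hq₂, hout, fun A B C x => ?_⟩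
  obtain ⟨p, hp⟩ := hM
  obtain ⟨d, hd, hlen⟩ := hp (twoStage A B C) x
  have hz₁ := (h₁ _ x d _ hd (by simp)).1
  have hz₂ := (h₂ (chi A (q₁ x)) _ x d _ hd (by
    rintro (_ | i) z hi hz
    · exact congrArg some (hz₁ z hz).symm
    · simp at hi)).1
  have hz₃ := (h₃ (chi A (q₁ x)) (chi (if chi A (q₁ x) then C else B) (q₂ (chi A (q₁ x)) x))
    _ x d _ hd (by
      rintro (_ | _ | i) z hi hz
      · exact congrArg some (hz₁ z hz).symm
      · rw [hz₂ z hz]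
        cases chi A (q₁ x) <;> simp [twoStage]
      · simp at hi)).2 hlen
  rw [hd.accepts_iff, hz₃]

end OracleTM

/-! ### An oracle machine that asks its input twice -/

section QueryMachine

variable {K Λ σ : Type} [DecidableEq K] [Fintype K] [Fintype Λ] [Fintype σ] {Γ : K ⊕ Unit → Type}
  (m : Λ → TM2.Stmt (fun k => Γ (.inl k)) Λ σ) (main : Λ) (init : σ) (k₀ k₁ : K)
  [Fintype (Γ (.inl k₀))] (i : Γ (.inl k₀) ≃ Bool) (o : Γ (.inl k₁) ≃ Bool ⊕ Bool)
  (q : Γ (.inr ()) ≃ Bool) (s : Bool)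

/-- Run the machine `m`. Its output consists of two queries, separated by a bit. -/
def queryProgram : Λ ⊕ Fin 7 →
    TM2.Stmt Γ (Λ ⊕ Fin 7) (σ × Option (Bool ⊕ Bool) × Bool × Bool × Bool)
  | .inl l => liftStmt Sum.inl Prod.fst (fun a v => (a, v.2)) Sum.inl (some (.inr 0)) (m l)
  -- Label `0` copies letters to the query stack until it meets the separating bit, which it stores,
  -- or the end. Labels `1` and `4` are the query states; `2`, `3` and `5`, `6` record their
  -- answers.
  | .inr 0 =>
    .pop (.inl k₁) (fun v x => (v.1, x.map o, v.2.2))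
      (.branch (fun v => v.2.1.isNone) (.goto fun _ => .inr 4)
        (.branch (fun v => (v.2.1.bind Sum.getLeft?).isSome)
          (.push (.inr ()) (fun v => q.symm ((v.2.1.bind Sum.getLeft?).getD false))
            (.goto fun _ => .inr 0))
          (.load (fun v => (v.1, none, (v.2.1.bind Sum.getRight?).getD false, v.2.2.2))
            (.goto fun _ => .inr 1))))
  | .inr 2 => .load (fun v => (v.1, v.2.1, v.2.2.1, false, v.2.2.2.2)) (.goto fun _ => .inr 0)
  | .inr 3 => .load (fun v => (v.1, v.2.1, v.2.2.1, true, v.2.2.2.2)) (.goto fun _ => .inr 0)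
  | .inr 5 => .load (fun v => (v.1, v.2.1, v.2.2.1, v.2.2.2.1, false)) .halt
  | .inr 6 => .load (fun v => (v.1, v.2.1, v.2.2.1, v.2.2.2.1, true)) .halt
  | .inr _ => .halt

/-- The oracle machine that asks the queries written by `m`. -/
def queryMachine : OracleTM where
  K := K ⊕ Unit
  k₀ := .inl k₀
  k₁ := .inl k₁
  Γ := Γ
  Λ := Λ ⊕ Fin 7
  main := .inl main
  σ := σ × Option (Bool ⊕ Bool) × Bool × Bool × Bool
  initialState := (init, none, false, false, false)
  m := queryProgram m k₁ o q
  inputAlphabet := i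
  queryStack := .inr ()
  queryAlphabet := q
  ask := Sum.elim (fun _ => none) fun l =>
    if l = 1 then some (.inr 2, .inr 3) else if l = 4 then some (.inr 5, .inr 6) else none
  accept v := v.2.2.1 ^^ bif v.2.2.2.1 then v.2.2.2.2 ^^ s else v.2.2.2.2

/-- A configuration of the oracle machine. -/
def queryCfg (h : List Bool)
    (c : TM2.Cfg Γ (Λ ⊕ Fin 7) (σ × Option (Bool ⊕ Bool) × Bool × Bool × Bool)) :
    (queryMachine m main init k₀ k₁ i o q s).Cfg :=
  ⟨c, h⟩

variable {m main init k₀ k₁ i o q s} {O : List Bool → Lang} {h : List Bool}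

theorem queryMachine_copy (u : Word) (v : σ × Option (Bool ⊕ Bool) × Bool × Bool × Bool)
    (S : ∀ k, List (Γ k)) (w : List (Γ (.inl k₁)))
    (hS : S (.inl k₁) = u.map (fun b => o.symm (.inl b)) ++ w) :
    ∃ r S', StepsTo ((queryMachine m main init k₀ k₁ i o q s).step O) u.length
        (queryCfg m main init k₀ k₁ i o q s h ⟨some (.inr 0), v, S⟩)
        (queryCfg m main init k₀ k₁ i o q s h ⟨some (.inr 0), (v.1, r, v.2.2), S'⟩) ∧
      S' (.inl k₁) = w ∧ S' (.inr ()) = (u.map q.symm).reverse ++ S (.inr ()) := by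
  induction u generalizing v S with
  | nil => exact ⟨_, S, rfl, hS, rfl⟩
  | cons b u ih =>
    obtain ⟨r, S', hr, h₁, h₂⟩ := ih (v.1, some (.inl b), v.2.2)
      (Function.update (Function.update S (.inl k₁) (u.map (fun b => o.symm (.inl b)) ++ w))
        (.inr ()) (q.symm b :: S (.inr ()))) (by simp)
    refine ⟨r, S', ⟨_, ?_, hr⟩, h₁, by simp [h₂]⟩
    refine (OracleTM.step_of_ask_eq_none _ rfl _ _ _).trans (congrArg some ?_)
    refine congrArg (queryCfg m main init k₀ k₁ i o q s h) ?_
    change TM2.stepAux (queryProgram m k₁ o q (.inr 0)) v S = _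
    simp [queryProgram, hS]

theorem queryMachine_bit (b : Bool) (v : σ × Option (Bool ⊕ Bool) × Bool × Bool × Bool)
    (S : ∀ k, List (Γ k)) (w : List (Γ (.inl k₁))) (hS : S (.inl k₁) = o.symm (.inr b) :: w) :
    StepsTo ((queryMachine m main init k₀ k₁ i o q s).step O) 1
      (queryCfg m main init k₀ k₁ i o q s h ⟨some (.inr 0), v, S⟩)
      (queryCfg m main init k₀ k₁ i o q s h ⟨some (.inr 1), (v.1, none, b, v.2.2.2),
        Function.update S (.inl k₁) w⟩) := by
  refine .single ((OracleTM.step_of_ask_eq_none _ rfl _ _ _).trans (congrArg some ?_))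
  refine congrArg (queryCfg m main init k₀ k₁ i o q s h) ?_
  change TM2.stepAux (queryProgram m k₁ o q (.inr 0)) v S = _
  simp [queryProgram, hS]

theorem queryMachine_end (v : σ × Option (Bool ⊕ Bool) × Bool × Bool × Bool)
    (S : ∀ k, List (Γ k)) (hS : S (.inl k₁) = []) :
    StepsTo ((queryMachine m main init k₀ k₁ i o q s).step O) 1
      (queryCfg m main init k₀ k₁ i o q s h ⟨some (.inr 0), v, S⟩)
      (queryCfg m main init k₀ k₁ i o q s h ⟨some (.inr 4), (v.1, none, v.2.2), S⟩) := by
  refine .single ((OracleTM.step_of_ask_eq_none _ rfl _ _ _).trans (congrArg some ?_))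
  refine congrArg (queryCfg m main init k₀ k₁ i o q s h) ?_
  change TM2.stepAux (queryProgram m k₁ o q (.inr 0)) v S = _
  simp [queryProgram, hS]

theorem queryMachine_ask₁ (x : Word) (v : σ × Option (Bool ⊕ Bool) × Bool × Bool × Bool)
    (S : ∀ k, List (Γ k)) (hS : S (.inr ()) = x.map q.symm) :
    StepsTo ((queryMachine m main init k₀ k₁ i o q s).step O) 2
      (queryCfg m main init k₀ k₁ i o q s h ⟨some (.inr 1), v, S⟩)
      (queryCfg m main init k₀ k₁ i o q s (h ++ [chi (O h) x])
        ⟨some (.inr 0), (v.1, v.2.1, v.2.2.1, chi (O h) x, v.2.2.2.2),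
          Function.update S (.inr ()) []⟩) := by
  have hx : (S (.inr ())).map q = x := by simp [hS]
  refine ⟨_, OracleTM.step_of_ask_eq_some
    (M := queryMachine m main init k₀ k₁ i o q s) (n := (Sum.inr 2 : Λ ⊕ Fin 7))
    (y := (Sum.inr 3 : Λ ⊕ Fin 7)) rfl _ _ _, ?_⟩
  change StepsTo _ 1 (queryCfg m main init k₀ k₁ i o q s (h ++ [chi (O h) ((S (.inr ())).map q)])
    ⟨some (if chi (O h) ((S (.inr ())).map q) then .inr 3 else .inr 2), v,
      Function.update S (.inr ()) []⟩) _
  rw [hx]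
  cases chi (O h) x <;> exact .single rfl

theorem queryMachine_ask₂ (x : Word) (v : σ × Option (Bool ⊕ Bool) × Bool × Bool × Bool)
    (S : ∀ k, List (Γ k)) (hS : S (.inr ()) = x.map q.symm) :
    StepsTo ((queryMachine m main init k₀ k₁ i o q s).step O) 2
      (queryCfg m main init k₀ k₁ i o q s h ⟨some (.inr 4), v, S⟩)
      (queryCfg m main init k₀ k₁ i o q s (h ++ [chi (O h) x])
        ⟨none, (v.1, v.2.1, v.2.2.1, v.2.2.2.1, chi (O h) x), Function.update S (.inr ()) []⟩) := by
  have hx : (S (.inr ())).map q = x := by simp [hS]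
  refine ⟨_, OracleTM.step_of_ask_eq_some
    (M := queryMachine m main init k₀ k₁ i o q s) (n := (Sum.inr 5 : Λ ⊕ Fin 7))
    (y := (Sum.inr 6 : Λ ⊕ Fin 7)) rfl _ _ _, ?_⟩
  change StepsTo _ 1 (queryCfg m main init k₀ k₁ i o q s (h ++ [chi (O h) ((S (.inr ())).map q)])
    ⟨some (if chi (O h) ((S (.inr ())).map q) then .inr 6 else .inr 5), v,
      Function.update S (.inr ()) []⟩) _
  rw [hx]
  cases chi (O h) x <;> exact .single rfl

/-- The two copies of `x` are produced in reverse because copying to the query stack reverses them.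
The six extra steps are one for the separator, one for the end and two for each query with its
recording. -/
theorem queryMachine_run {n : ℕ} {x : Word} {b : Bool}
    (hm : StepsTo (TM2.step m) n
      ⟨some main, init, Function.update (fun _ => []) k₀ (x.map i.symm)⟩
      ⟨none, init, Function.update (fun _ => []) k₁
        ((x.reverse.map Sum.inl ++ ([Sum.inr b] ++ x.reverse.map Sum.inl)).map o.symm)⟩) :
    ∃ v S, StepsTo ((queryMachine m main init k₀ k₁ i o q s).step O) (n + 2 * x.length + 6)
      ((queryMachine m main init k₀ k₁ i o q s).init x)
      (queryCfg m main init k₀ k₁ i o q s [chi (O []) x, chi (O [chi (O []) x]) x]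
        ⟨none, (v, none, b, chi (O []) x, chi (O [chi (O []) x]) x), S⟩) := by
  obtain ⟨S₁, r₁, hS₁, hS₁'⟩ := StepsTo.lift_run (ι := Sum.inl) (get := Prod.fst)
    (set := fun a (v : σ × Option (Bool ⊕ Bool) × Bool × Bool × Bool) => (a, v.2))
    Sum.inl_injective (fun _ _ => rfl) (fun _ _ _ => rfl) (fun _ => rfl) Sum.inl (some (.inr 0))
    ((queryMachine m main init k₀ k₁ i o q s).step O) (queryCfg m main init k₀ k₁ i o q s []) m
    (fun l v S => OracleTM.step_of_ask_eq_none _ rfl _ _ _)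
    (v := (init, none, false, false, false))
    (S := Function.update (fun _ => []) (.inl k₀) (x.map i.symm)) hm (fun k => by
      by_cases h : k = k₀
      · subst h; simp
      · simp [h])
  have e₁ := hS₁ k₁
  rw [Function.update_self, List.map_append, List.map_map, List.singleton_append,
    List.map_cons] at e₁
  have e₁' : S₁ (.inr ()) = [] := by rw [hS₁' _ (by simp)]; simp
  obtain ⟨c₂, S₂, r₂, hS₂, hS₂'⟩ := queryMachine_copy (m := m) (main := main) (init := init)
    (i := i) (o := o) (q := q) (s := s) (O := O) (h := []) x.reverse _ S₁ _ e₁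
  have r₃ := queryMachine_bit (m := m) (main := main) (init := init)
    (i := i) (o := o) (q := q) (s := s) (O := O) (h := []) b
    (init, c₂, false, false, false) S₂ _ hS₂
  have r₄ := queryMachine_ask₁ (m := m) (main := main) (init := init)
    (i := i) (o := o) (q := q) (s := s) (O := O) (h := []) x (init, none, b, false, false)
    (Function.update S₂ (.inl k₁) ((x.reverse.map Sum.inl).map o.symm)) (by
      rw [Function.update_of_ne (by simp), hS₂', e₁']
      simp)
  obtain ⟨c₅, S₅, r₅, hS₅, hS₅'⟩ := queryMachine_copy (m := m) (main := main) (init := init)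
    (i := i) (o := o) (q := q) (s := s) (O := O) (h := [chi (O []) x]) x.reverse
    (init, none, b, chi (O []) x, false) (Function.update (Function.update S₂ (.inl k₁)
      ((x.reverse.map Sum.inl).map o.symm)) (.inr ()) []) [] (by simp [Function.comp_def])
  have r₆ := queryMachine_end (m := m) (main := main) (init := init)
    (i := i) (o := o) (q := q) (s := s) (O := O) (h := [chi (O []) x])
    (init, c₅, b, chi (O []) x, false) S₅ hS₅
  have r₇ := queryMachine_ask₂ (m := m) (main := main) (init := init)
    (i := i) (o := o) (q := q) (s := s) (O := O) (h := [chi (O []) x]) x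
    (init, none, b, chi (O []) x, false) S₅ (by rw [hS₅']; simp)
  refine ⟨init, Function.update S₅ (.inr ()) [], ?_⟩
  have := r₁.trans (r₂.trans (r₃.trans (r₄.trans (r₅.trans (r₆.trans r₇)))))
  rw [List.length_reverse] at this
  convert this using 1
  · omega
  · rfl
  · rfl

end QueryMachine

theorem exists_queryMachine {φ : Word → Bool} (hφ : PolyTime id Computability.encodeBool φ)
    (s : Bool) : ∃ M : OracleTM, M.PolyTimeQueries 2 ∧ ∀ A B C x,
      M.Accepts (twoStage A B C) x ↔
        (φ x ^^ bif chi A x then chi C x ^^ s else chi B x) = true := by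
  have hrev : PolyTime id id fun x : Word => x.reverse.map (Sum.inl : Bool → Bool ⊕ Bool) :=
    polyTime_reverse.map _
  have hbit : PolyTime id id fun x : Word => [(Sum.inr (φ x) : Bool ⊕ Bool)] :=
    (polyTime_encodeBool_iff.1 hφ).map Sum.inr
  obtain ⟨M, i, o, p, hM⟩ := (hrev.append (hbit.append hrev)).exists_run
  have := M.kFin
  have := M.ΛFin
  have := M.σFin
  let Γ : M.K ⊕ Unit → Type := Sum.elim M.Γ fun _ => Bool
  have : Fintype (Γ (.inl M.k₀)) := M.Γk₀Fin
  let Q : OracleTM := queryMachine (Γ := Γ) M.m M.main M.initialState M.k₀ M.k₁ i o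
    (Equiv.refl Bool) s
  have key : ∀ O x, ∃ v S, Q.HaltsIn O x (queryCfg (Γ := Γ) M.m M.main M.initialState M.k₀ M.k₁ i o
      (Equiv.refl Bool) s [chi (O []) x, chi (O [chi (O []) x]) x]
      ⟨none, (v, none, φ x, chi (O []) x, chi (O [chi (O []) x]) x), S⟩)
      ((p + 2 * Polynomial.X + 6).eval x.length) := by
    intro O x
    obtain ⟨n, hn, hrun⟩ := hM x
    obtain ⟨v, S, h⟩ := queryMachine_run (Γ := Γ) (q := Equiv.refl Bool) (s := s) (O := O) hrun
    refine ⟨v, S, evalsToInTime_iff.2 ⟨_, ?_, h⟩, rfl⟩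
    simp only [id] at hn
    simp
    omega
  refine ⟨Q, ⟨p + 2 * Polynomial.X + 6, fun O x => ?_⟩, fun A B C x => ?_⟩
  · obtain ⟨v, S, h⟩ := key O x
    exact ⟨_, h, Nat.le_refl 2⟩
  · obtain ⟨v, S, h⟩ := key (twoStage A B C) x
    rw [h.accepts_iff]
    change (φ x ^^ bif chi A x then chi (twoStage A B C [chi A x]) x ^^ s else
      chi (twoStage A B C [chi A x]) x) = true ↔ _
    cases chi A x <;> rfl

/-! ### Truth-table reductions and mind changes -/

section TruthTables

/-- A truth-table reduction has a single oracle, so several languages are joined by prefixes: the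
newest behind `false`, the earlier join behind `true`. -/
theorem exists_join_mem_NP {A : ℕ → Lang} (hA : ∀ i, A i ∈ NP) (m : ℕ) :
    ∃ B ∈ NP, ∃ q : ℕ → Word → Word, (∀ i, PolyTime id id (q i)) ∧
      ∀ i < m, ∀ x, q i x ∈ B ↔ x ∈ A i := by
  induction m with
  | zero => exact ⟨∅, empty_mem_NP, fun _ x => x, fun _ => polyTime_encode id, by simp⟩
  | succ m ih =>
    obtain ⟨B, hB, q, hq, h⟩ := ih
    have hhead : ∀ b : Bool, {w : Word | (w.head? == some b) = true} ∈ NP := fun b =>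
      setOf_mem_NP ((polyTime_encode id).head (· == some b))
    have htail : PolyTime id id fun w : Word => w.tail := (polyTime_encode id).tail
    refine ⟨_, union_mem_NP (inter_mem_NP (hhead true) (preimage_mem_NP hB htail))
      (inter_mem_NP (hhead false) (preimage_mem_NP (hA m) htail)),
      fun i x => if i < m then true :: q i x else false :: x, fun i => ?_, fun i hi x => ?_⟩
    · by_cases hi : i < m
      · simp only [hi, if_true]
        exact (polyTime_const [true]).append (hq i)
      · simp only [hi, if_false]
        exact (polyTime_const [false]).append (polyTime_encode id)
    · by_cases hi' : i < m
      · simp [hi', h i hi' x]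
      · obtain rfl : i = m := by omega
        simp

theorem polyTime_flatten_ofFn {α αΓ β : Type} [Fintype αΓ] [Inhabited αΓ] [Fintype β]
    [Inhabited β] {ea : α → List αΓ} {m : ℕ} {F : Fin m → α → List β}
    (hF : ∀ i, PolyTime ea id (F i)) :
    PolyTime ea id fun a => (List.ofFn fun i => F i a).flatten := by
  induction m with
  | zero => simpa using polyTime_const []
  | succ m ih =>
    simp only [List.ofFn_succ, List.flatten_cons]
    exact (hF 0).append (ih fun i => hF i.succ)

theorem mindChange_subset_RTT (m : ℕ) : MindChange m ⊆ RTT m NP := by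
  rintro L ⟨φ, N, hφ, hm, hN, hL⟩
  obtain ⟨B, hB, q, hq, hqB⟩ := exists_join_mem_NP hN m
  -- Query `i` asks whether `i < N x`, so the number of positive answers is `N x`.
  let parity (b : Bool) (e : Fin m → Bool) : Bool :=
    b ^^ decide (Odd (Finset.univ.filter fun i => e i = true).card)
  refine ⟨B, hB, fun x => (fun i => q i x, parity (φ x)), ?_, fun x => ?_⟩
  · have h : PolyTime id id fun x =>
        (List.ofFn fun i : Fin m => (q i x).map some ++ [none]).flatten :=
      polyTime_flatten_ofFn fun i => ((hq i).map some).append (polyTime_const [none])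
    -- As `m` is fixed, the truth table is one of two constant words, selected by `φ x`.
    refine (h.append (hφ.ite (polyTime_const ((truthTable (parity true)).map some))
      (polyTime_const ((truthTable (parity false)).map some)))).congr id (fun _ => rfl)
      fun x => ?_
    have : ∀ b, (if b = true then (truthTable (parity true)).map some
        else (truthTable (parity false)).map some) = (truthTable (parity b)).map some := by
      rintro (_ | _) <;> rfl
    exact congrArg (_ ++ ·) (this (φ x))
  · have hcard : (Finset.univ.filter fun i : Fin m => chi B (q i x) = true).card = N x := by
      have : (Finset.univ.filter fun i : Fin m => chi B (q i x) = true).map Fin.valEmbedding =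
          Finset.range (N x) := by
        ext i
        simp only [Finset.mem_map, Finset.mem_filter, Finset.mem_univ, true_and,
          Fin.valEmbedding_apply, Finset.mem_range]
        simp only [chi, decide_eq_true_eq]
        constructor
        · rintro ⟨i, hi, rfl⟩
          exact (hqB i i.2 x).1 hi
        · intro hi
          have him := hi.trans_le (hm x)
          exact ⟨⟨i, him⟩, (hqB i him x).2 hi, rfl⟩
      rw [← Finset.card_map Fin.valEmbedding, this, Finset.card_range]
    rw [hL]
    simp only [parity, hcard]

/-- The letters before the first separator. -/
def takeBlock (w : List (Option Bool)) : Word :=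
  (w.takeWhile Option.isSome).filterMap id

/-- The letters after the first separator. -/
def dropBlock (w : List (Option Bool)) : List (Option Bool) :=
  (w.dropWhile Option.isSome).tail

theorem polyTime_takeBlock : PolyTime id id takeBlock := by
  refine (polyTime_transduce (fun s x => s && x.isSome) (fun s x => bif s then x else none)
    (fun _ => none) true).congr id (fun _ => rfl) fun w => ?_
  have h : ∀ w : List (Option Bool), transduce (fun s x => s && x.isSome)
      (fun s x => bif s then x else none) (fun _ => (none : Option Bool)) false w = [] := by
    intro w
    induction w with
    | nil => rfl
    | cons a w ih => simpa [transduce] using ih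
  simp only [id, takeBlock]
  induction w with
  | nil => rfl
  | cons a w ih =>
    cases a with
    | none => simp [transduce, h]
    | some b => simp [transduce, ih]

theorem polyTime_dropBlock : PolyTime id id dropBlock := by
  refine (polyTime_transduce (fun s x => s || x.isNone) (fun s x => bif s then some x else none)
    (fun _ => none) false).congr id (fun _ => rfl) fun w => ?_
  have h : ∀ w : List (Option Bool), transduce (fun s x => s || x.isNone)
      (fun s x => bif s then some x else none) (fun _ => (none : Option (Option Bool))) true w =
        w := by
    intro w
    induction w with
    | nil => rfl
    | cons a w ih => simpa [transduce] using ih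
  simp only [id, dropBlock]
  induction w with
  | nil => rfl
  | cons a w ih =>
    cases a with
    | none => simp [transduce, h]
    | some b => simp [transduce, ih]

theorem takeBlock_append (u : Word) (w : List (Option Bool)) :
    takeBlock (u.map some ++ none :: w) = u := by
  induction u with
  | nil => simp [takeBlock]
  | cons b u ih => simpa [takeBlock] using ih

theorem dropBlock_append (u : Word) (w : List (Option Bool)) :
    dropBlock (u.map some ++ none :: w) = w := by
  induction u with
  | nil => simp [dropBlock]
  | cons b u ih => simpa [dropBlock] using ih

theorem dropBlock_iterate (l : List Word) (t : List (Option Bool)) (n : ℕ) (hn : n ≤ l.length) :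
    dropBlock^[n] ((l.map fun u => u.map some ++ [none]).flatten ++ t) =
      ((l.drop n).map fun u => u.map some ++ [none]).flatten ++ t := by
  induction n generalizing l with
  | zero => simp
  | succ n ih =>
    cases l with
    | nil => simp at hn
    | cons u l =>
      rw [Function.iterate_succ_apply, List.map_cons, List.flatten_cons, List.append_assoc,
        List.append_assoc, List.singleton_append, dropBlock_append]
      exact ih l (by simpa using hn)

variable {m : ℕ}

theorem encodeTT_eq (o : (Fin m → Word) × ((Fin m → Bool) → Bool)) :
    encodeTT o = ((List.ofFn o.1).map fun u => u.map some ++ [none]).flatten ++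
      (truthTable o.2).map some := by
  rw [encodeTT, List.map_ofFn]
  rfl

theorem takeBlock_encodeTT (o : (Fin m → Word) × ((Fin m → Bool) → Bool)) (i : Fin m) :
    takeBlock (dropBlock^[i] (encodeTT o)) = o.1 i := by
  rw [encodeTT_eq, dropBlock_iterate _ _ _ (by simp), List.drop_eq_getElem_cons (by simp),
    List.map_cons, List.flatten_cons, List.append_assoc, List.append_assoc,
    List.singleton_append, takeBlock_append]
  simp

/-- The entry for the assignment `e` stands where the position has the binary digits `e`. For fixed
`m` and `e` it is reached by a constant number of deletions, so it can be read off in polynomial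
time. -/
theorem head_encodeTT (o : (Fin m → Word) × ((Fin m → Bool) → Bool)) (e : Fin m → Bool) :
    (List.tail^[Nat.ofBits e] (dropBlock^[m] (encodeTT o))).head? = some (some (o.2 e)) := by
  have htail : ∀ n (w : List (Option Bool)), List.tail^[n] w = w.drop n := by
    intro n
    induction n with
    | zero => simp
    | succ n ih => intro w; rw [Function.iterate_succ_apply, ih]; simp
  rw [encodeTT_eq, dropBlock_iterate _ _ _ (by simp), htail,
    List.drop_eq_nil_of_le (as := List.ofFn o.1) (by simp)]
  simp [truthTable, List.head?_drop, Nat.ofBits_lt_two_pow]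

theorem polyTime_iterate {α αΓ β : Type} [Inhabited αΓ] [Fintype β] [Inhabited β]
    {ea : α → List αΓ} {F : α → List β} {G : List β → List β} (hG : PolyTime id id G)
    (hF : PolyTime ea id F) (n : ℕ) : PolyTime ea id fun a => G^[n] (F a) := by
  induction n with
  | zero => exact hF
  | succ n ih =>
    simp only [Function.iterate_succ_apply']
    exact hG.comp ih

/-- The `m` positive answers are the events and the predicate of the reduction is `g`; with only `m`
events a chain has at most `m` changes. -/
theorem RTT_subset_mindChange (m : ℕ) : RTT m NP ⊆ MindChange m := by
  classical
  rintro L ⟨B, hB, f, hf, hL⟩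
  have hcode : PolyTime id id fun x => encodeTT (f x) :=
    hf.congr id (fun _ => rfl) fun _ => rfl
  have hblock := polyTime_iterate polyTime_dropBlock hcode
  refine mem_mindChange_of_events (E := fun i : Fin m => {x | (f x).1 i ∈ B})
    (g := fun x S => (f x).2 fun i => decide (i ∈ S)) (fun i => ?_) (fun S => ?_) (fun x => ?_)
    fun x S h => ?_
  · refine preimage_mem_NP hB ?_
    simpa only [takeBlock_encodeTT] using polyTime_takeBlock.comp (hblock i)
  · have h := (polyTime_iterate (polyTime_encode id).tail (hblock m)
      (Nat.ofBits fun i => decide (i ∈ S))).head (· == some (some true))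
    refine h.congr id (fun _ => rfl) fun x => ?_
    have := head_encodeTT (f x) fun i => decide (i ∈ S)
    simp only [id]
    rw [this]
    cases (f x).2 fun i => decide (i ∈ S) <;> rfl
  · rw [hL]
    have : (fun i => chi B ((f x).1 i)) =
        fun i => decide (i ∈ Finset.univ.filter fun i => x ∈ {x | (f x).1 i ∈ B}) := by
      funext i
      simp [chi]
    rw [this]
  · have h₁ := h.le_card (Y := Finset.univ) (fun S => by rw [Finset.inter_univ])
    have h₂ := Finset.card_le_univ (S ∩ Finset.univ)
    simp only [Fintype.card_fin] at h₂
    omega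

theorem mindChange_eq_RTT (m : ℕ) : MindChange m = RTT m NP :=
  (mindChange_subset_RTT m).antisymm (RTT_subset_mindChange m)

end TruthTables

theorem queryClass_eq_mindChange {j k l : ℕ} (hj : 1 ≤ j) (hk : 1 ≤ k) (hl : 1 ≤ l) :
    queryClass (BH j) (BH k) (BH l) =
      MindChange (if Even j ∧ Odd l then j + k + l - 1 else j + k + l) := by
  ext L
  constructor
  · rintro ⟨M, hM, A, hA, B, hB, C, hC, hL⟩
    obtain ⟨q₁, q₂, out, hq₁, hq₂, hout, h⟩ := hM.exists_two_queries
    exact mem_mindChange_of_queries hk hA hB hC hq₁ hq₂ hout fun x => (hL x).trans (h A B C x)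
  · intro hL
    obtain ⟨φ, s, hφ, A, hA, B, hB, C, hC, hL⟩ := exists_queries_of_mem_mindChange hj hk hl hL
    obtain ⟨M, hM, h⟩ := exists_queryMachine hφ s
    exact ⟨M, hM, A, hA, B, hB, C, hC, fun x => (hL x).trans (h A B C x).symm⟩

end QueryOrder

theorem theorem4p1 (j k l : ℕ) (hj : 1 ≤ j) (hk : 1 ≤ k) (hl : 1 ≤ l) :
    QueryOrder.queryClass (QueryOrder.BH j) (QueryOrder.BH k) (QueryOrder.BH l) =
      if Even j ∧ Odd l then QueryOrder.RTT (j + k + l - 1) QueryOrder.NP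
      else QueryOrder.RTT (j + k + l) QueryOrder.NP := by
  rw [QueryOrder.queryClass_eq_mindChange hj hk hl, QueryOrder.mindChange_eq_RTT]
  split_ifs <;> rfl
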